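/- Let $\delta\ge 0$ be a real number, $n\ge 0$ an integer, and let $X$ be an $n$-dimensional simplicial complex (it has an $n$-simplex and no simplex of dimension greater than $n$; it need not be locally finite) endowed with a length metric $|\cdot\,\cdot|$, i.e. for any two points $x,y\in X$ and any $\varepsilon>0$ there is a path from $x$ to $y$ of length at most $|x\,y|+\varepsilon$ (for instance, any geodesic metric). The metric is required to induce the metric topology of the complex, that is, the coarsest topology for which the barycentric coordinates are continuous (for a locally finite complex this is the usual weak topology). For $x,y,z\in X$ write $\langle y,z\rangle_x=\frac12\big(|x\,y|+|x\,z|-|y\,z|\big)$, and assume that $X$ is $\delta$-hyperbolic, i.e. for all $x,y,z,t\in X$, $$\langle x,z\rangle_t\ \ge\ \min\{\langle x,y\rangle_t,\langle y,z\rangle_t\}-\delta .$$ Assume that for every $x\in X$ and every $r$ with $0<r\le 8(n+1)\delta$, the open ball $B(x,r)$ is null-homotopic in the open ball $B(x,r+4\delta)$, i.e. the inclusion $B(x,r)\hookrightarrow B(x,r+4\delta)$ is homotopic, as a map into $B(x,r+4\delta)$, to a constant map. Then all homotopy groups of $X$ are trivial: for every $k\ge 0$ and every base point $x\in X$, $\pi_k(X,x)$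 has exactly one element (for $k=0$: $X$ is path-connected). Moreover, $X$ is contractible. -/

import Mathlib

open scoped Topology

noncomputable section

namespace AbstractSimplicialComplex

/-- The geometric realization of an abstract simplicial complex, as the set of families of
barycentric coordinates: a point is a family of nonnegative weights on the vertices that is carried
by a simplex and has total weight `1`. As a subspace of `ι → ℝ` it carries the coarsest topology
making the barycentric coordinates continuous. This is the topology of the usual metrics
`∑ v, |p v - q v|` or `sqrt (∑ v, (p v - q v) ^ 2)` on the realization, hence also that of the
length metric with simplices of edge length one on a connected finite-dimensional complex. It agrees
with the weak topology exactly when the complex is locally finite, that is, exactly when the weak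
topology is metrizable. -/
def realization {ι : Type*} (K : AbstractSimplicialComplex ι) : Set (ι → ℝ) :=
  {p | (∀ v, 0 ≤ p v) ∧ ∃ s ∈ K.faces, (∀ v, v ∉ s → p v = 0) ∧ ∑ v ∈ s, p v = 1}

/-- The complex is `n`-dimensional: it has an `n`-simplex and no simplex of larger dimension. -/
def HasDimension {ι : Type*} (K : AbstractSimplicialComplex ι) (n : ℕ) : Prop :=
  (∃ s ∈ K.faces, s.card = n + 1) ∧ ∀ s ∈ K.faces, s.card ≤ n + 1

end AbstractSimplicialComplex

/-- The Gromov product of `y` and `z` with base point `x`. -/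
def gromovProduct {X : Type*} [MetricSpace X] (y z x : X) : ℝ :=
  (dist x y + dist x z - dist y z) / 2

/-- `δ`-hyperbolicity of a metric space, through the four point condition. -/
def IsGromovHyperbolic (X : Type*) [MetricSpace X] (δ : ℝ) : Prop :=
  ∀ x y z t : X, min (gromovProduct x y t) (gromovProduct y z t) - δ ≤ gromovProduct x z t

/-- The metric is a length metric: any two points are joined by paths whose length is as close as
desired to their distance. Every geodesic space has this property. -/
def IsLengthMetric (X : Type*) [MetricSpace X] : Prop :=
  ∀ x y : X, ∀ ε : ℝ, 0 < ε →
    ∃ γ : Path x y, eVariationOn γ Set.univ ≤ ENNReal.ofReal (dist x y + ε)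

/-- The subset `s` is homotopic to zero in the set `t`: it is contained in `t`, and the inclusion
`s → t` is homotopic, as a map to `t`, to a constant map. -/
def IsNullHomotopicIn {X : Type*} [TopologicalSpace X] (s t : Set X) : Prop :=
  ∃ h : s ⊆ t, ContinuousMap.Nullhomotopic (⟨Set.inclusion h, continuous_inclusion h⟩ : C(s, t))

end

/-! For `δ > 0` the core is a filling statement: a map to `X` from the boundary of a cube of
dimension between 1 and n + 1 extends over the cube. Coning the map off along almost geodesics to a
fixed point gives a filling that need not be continuous, but hyperbolicity makes nearby points have
images less than 4δ + η apart (`exists_coarse_extension`). Subdivide finely, keep this filling on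
the vertices and the given map on the boundary, and fill the other cells by increasing dimension,
inside balls that the hypothesis makes null-homotopic. Each dimension costs 8δ + η in radius, and n
+ 1 dimensions just fit under the allowed bound (`exists_cube_extension`).

To contract `X`, make the complex cubical by normalizing the largest coordinate to 1. The cells of
the cylinder over it have dimension at most n + 1, so fillings give, cell by cell, a homotopy from
the tautological map to a constant (`exists_cellwise_contraction`). Continuity on cells is too weak
for the metric topology when the complex is not locally finite. Truncating barycentric coordinates
repairs this: truncation is homotopic to the identity along straight segments, and near each point
it leaves only finitely many nonzero coordinates, hence finitely many cells.

For `δ = 0` the space is geodesic and contracts along geodesics to a base point. Finally, in a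
contractible space two generalized loops are joined by filling a prism. -/

/-! ### Cells of the integral lattice and skeletal induction. -/

/-- The cell of the integral cubical decomposition of `J → ℝ` with base point `a` and free
coordinates `F`. -/
def intCell {J : Type*} (a : J → ℤ) (F : Finset J) : Set (J → ℝ) :=
  {q | (∀ j ∈ F, (a j : ℝ) ≤ q j ∧ q j ≤ a j + 1) ∧ ∀ j ∉ F, q j = a j}

/-- The relative boundary of `intCell a F`. -/
def intCellBdry {J : Type*} (a : J → ℤ) (F : Finset J) : Set (J → ℝ) :=
  {q | q ∈ intCell a F ∧ ∃ j ∈ F, q j = a j ∨ q j = a j + 1}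

section Cells

variable {J : Type*}

theorem intCellBdry_subset (a : J → ℤ) (F : Finset J) : intCellBdry a F ⊆ intCell a F :=
  fun _ h => h.1

theorem base_mem_intCell (a : J → ℤ) (F : Finset J) : (fun j => (a j : ℝ)) ∈ intCell a F :=
  ⟨fun j _ => ⟨le_rfl, by simp⟩, fun j _ => rfl⟩

theorem isClosed_intCell (a : J → ℤ) (F : Finset J) : IsClosed (intCell a F) := by
  have : intCell a F = (⋂ j ∈ F, {q : J → ℝ | (a j : ℝ) ≤ q j ∧ q j ≤ a j + 1}) ∩
      ⋂ j, ⋂ (_ : j ∉ F), {q : J → ℝ | q j = a j} := by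
    ext q; simp [intCell]
  rw [this]
  refine IsClosed.inter ?_ ?_
  · refine isClosed_biInter fun j _ => ?_
    exact (isClosed_le continuous_const (continuous_apply j)).inter
      (isClosed_le (continuous_apply j) continuous_const)
  · exact isClosed_iInter fun j => isClosed_iInter fun _ =>
      isClosed_eq (continuous_apply j) continuous_const

open Classical in
theorem intCell_erase_subset {a : J → ℤ} {F : Finset J} {j : J} (hj : j ∈ F) :
    intCell a (F.erase j) ⊆ intCellBdry a F := by
  rintro q ⟨h1, h2⟩
  have hqj : q j = a j := h2 j (by simp)
  refine ⟨⟨fun i hi => ?_, fun i hi => h2 i (by simp [hi])⟩, j, hj, Or.inl hqj⟩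
  by_cases hij : i = j
  · subst hij; rw [hqj]; simp
  · exact h1 i (by simp [hi, hij])

open Classical in
theorem intCell_update_subset {a : J → ℤ} {F : Finset J} {j : J} (hj : j ∈ F) :
    intCell (Function.update a j (a j + 1)) (F.erase j) ⊆ intCellBdry a F := by
  rintro q ⟨h1, h2⟩
  have hqj : q j = a j + 1 := by simpa using h2 j (by simp)
  refine ⟨⟨fun i hi => ?_, fun i hi => ?_⟩, j, hj, Or.inr hqj⟩
  · by_cases hij : i = j
    · subst hij; rw [hqj]; simp
    · simpa [hij] using h1 i (by simp [hi, hij])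
  · have hij : i ≠ j := fun h => hi (h ▸ hj)
    simpa [hij] using h2 i (by simp [hi])

open Classical in
theorem mem_facet_of_mem_intCellBdry {a : J → ℤ} {F : Finset J} {q : J → ℝ}
    (hq : q ∈ intCellBdry a F) : ∃ j ∈ F, q ∈ intCell a (F.erase j) ∪
      intCell (Function.update a j (a j + 1)) (F.erase j) := by
  obtain ⟨⟨h1, h2⟩, j, hj, h | h⟩ := hq
  · refine ⟨j, hj, Or.inl ⟨fun i hi => h1 i (Finset.mem_of_mem_erase hi), fun i hi => ?_⟩⟩
    by_cases hij : i = j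
    · subst hij; exact h
    · exact h2 i (by simpa [hij] using hi)
  · refine ⟨j, hj, Or.inr ⟨fun i hi => ?_, fun i hi => ?_⟩⟩
    · simpa [Finset.ne_of_mem_erase hi] using h1 i (Finset.mem_of_mem_erase hi)
    · by_cases hij : i = j
      · subst hij; simpa using h
      · simpa [hij] using h2 i (by simpa [hij] using hi)

theorem exists_facet_of_mem_intCellBdry {a : J → ℤ} {F : Finset J} {q : J → ℝ}
    (hq : q ∈ intCellBdry a F) :
    ∃ b G, intCell b G ⊆ intCellBdry a F ∧ G.card < F.card ∧ q ∈ intCell b G := by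
  classical
  obtain ⟨j, hj, h | h⟩ := mem_facet_of_mem_intCellBdry hq
  · exact ⟨_, _, intCell_erase_subset hj, Finset.card_erase_lt_of_mem hj, h⟩
  · exact ⟨_, _, intCell_update_subset hj, Finset.card_erase_lt_of_mem hj, h⟩

theorem continuousOn_intCellBdry {X : Type*} [TopologicalSpace X] {a : J → ℤ} {F : Finset J}
    {f : (J → ℝ) → X} (h : ∀ b G, intCell b G ⊆ intCellBdry a F → G.card < F.card →
      ContinuousOn f (intCell b G)) : ContinuousOn f (intCellBdry a F) := by
  classical
  have : intCellBdry a F ⊆ ⋃ j : F, (intCell a (F.erase j.1) ∪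
      intCell (Function.update a j.1 (a j.1 + 1)) (F.erase j.1)) := by
    intro q hq
    obtain ⟨j, hj, h⟩ := mem_facet_of_mem_intCellBdry hq
    exact Set.mem_iUnion.2 ⟨⟨j, hj⟩, h⟩
  refine ContinuousOn.mono ?_ this
  refine (locallyFinite_of_finite _).continuousOn_iUnion
    (fun j => (isClosed_intCell _ _).union (isClosed_intCell _ _)) fun j => ?_
  exact (h _ _ (intCell_erase_subset j.2) (Finset.card_erase_lt_of_mem j.2)).union_of_isClosed
    (h _ _ (intCell_update_subset j.2) (Finset.card_erase_lt_of_mem j.2))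
    (isClosed_intCell _ _) (isClosed_intCell _ _)

/-- The point determines the cell: the base is the vector of floors, and the free coordinates are
the non-integral ones. -/
theorem eq_of_mem_relInterior {a b : J → ℤ} {F G : Finset J} {q : J → ℝ}
    (h : q ∈ intCell a F \ intCellBdry a F) (h' : q ∈ intCell b G \ intCellBdry b G) :
    a = b ∧ F = G := by
  have key : ∀ {a : J → ℤ} {F : Finset J}, q ∈ intCell a F \ intCellBdry a F →
      (∀ j, a j = ⌊q j⌋) ∧ ∀ j, j ∈ F ↔ q j ≠ ⌊q j⌋ := by
    rintro a F ⟨⟨h1, h2⟩, h3⟩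
    have h3 : ∀ j ∈ F, q j ≠ a j ∧ q j ≠ a j + 1 := by
      intro j hj
      by_contra hc
      exact h3 ⟨⟨h1, h2⟩, j, hj, by tauto⟩
    have hfl : ∀ j, a j = ⌊q j⌋ := by
      intro j
      by_cases hj : j ∈ F
      · symm; rw [Int.floor_eq_iff]
        exact ⟨(h1 j hj).1, lt_of_le_of_ne (h1 j hj).2 (h3 j hj).2⟩
      · rw [h2 j hj]; simp
    refine ⟨hfl, fun j => ⟨fun hj => by rw [← hfl]; exact (h3 j hj).1, fun hj => ?_⟩⟩
    by_contra hc
    exact hj (by rw [← hfl]; exact h2 j hc)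
  refine ⟨funext fun j => ((key h).1 j).trans ((key h').1 j).symm, ?_⟩
  ext j; rw [(key h).2, (key h').2]

/-- Construction of a map by induction over the skeleta of a cubical complex. -/
theorem exists_skeletal_extension {X : Type*} [TopologicalSpace X] [Nonempty X]
    (W : Set (J → ℝ)) (P : (J → ℤ) → Finset J → ((J → ℝ) → X) → Prop)
    (hP : ∀ a F f g, Set.EqOn f g (intCell a F) → P a F f → P a F g)
    (hext : ∀ a F f, intCell a F ⊆ W → ContinuousOn f (intCellBdry a F) →
      (∀ b G, intCell b G ⊆ intCellBdry a F → G.card < F.card → P b G f) →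
      ∃ f', ContinuousOn f' (intCell a F) ∧ Set.EqOn f' f (intCellBdry a F) ∧ P a F f') (d : ℕ) :
    ∃ f : (J → ℝ) → X, ∀ a F, intCell a F ⊆ W → F.card < d →
      ContinuousOn f (intCell a F) ∧ P a F f := by
  classical
  induction d with
  | zero => exact ⟨fun _ => Classical.arbitrary X, by simp⟩
  | succ d ih =>
    obtain ⟨f, hf⟩ := ih
    have h1 : ∀ c : (J → ℤ) × Finset J, ∃ f' : (J → ℝ) → X,
        intCell c.1 c.2 ⊆ W → c.2.card = d →
          ContinuousOn f' (intCell c.1 c.2) ∧ Set.EqOn f' f (intCellBdry c.1 c.2) ∧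
            P c.1 c.2 f' := by
      rintro ⟨a, F⟩
      by_cases hc : intCell a F ⊆ W ∧ F.card = d
      · have hb : ∀ b G, intCell b G ⊆ intCellBdry a F → G.card < F.card →
            ContinuousOn f (intCell b G) ∧ P b G f := fun b G hbG hG =>
          hf b G (hbG.trans ((intCellBdry_subset a F).trans hc.1)) (hc.2 ▸ hG)
        obtain ⟨f', hf'⟩ := hext a F f hc.1
          (continuousOn_intCellBdry fun b G h h' => (hb b G h h').1) fun b G h h' => (hb b G h h').2
        exact ⟨f', fun _ _ => hf'⟩
      · exact ⟨f, fun h h' => absurd ⟨h, h'⟩ hc⟩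
    choose E hE using h1
    -- The new fillings are used only on relative interiors of d-cells; these are disjoint, so the
    -- choice is unambiguous.
    let g : (J → ℝ) → X := fun q =>
      if h : ∃ c : (J → ℤ) × Finset J, intCell c.1 c.2 ⊆ W ∧ c.2.card = d ∧
        q ∈ intCell c.1 c.2 \ intCellBdry c.1 c.2 then E h.choose q else f q
    have hg_int : ∀ a F q, intCell a F ⊆ W → F.card = d → q ∈ intCell a F \ intCellBdry a F →
        g q = E (a, F) q := by
      intro a F q hW hF hq
      have h : ∃ c : (J → ℤ) × Finset J, intCell c.1 c.2 ⊆ W ∧ c.2.card = d ∧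
        q ∈ intCell c.1 c.2 \ intCellBdry c.1 c.2 := ⟨(a, F), hW, hF, hq⟩
      have hc : h.choose = (a, F) := by
        obtain ⟨e1, e2⟩ := eq_of_mem_relInterior h.choose_spec.2.2 hq
        exact Prod.ext e1 e2
      simp only [g, dif_pos h, hc]
    -- Descending through facets puts a point of a lower cell in the relative interior of a cell of
    -- dimension below d, hence in that of no d-cell.
    have hg_low : ∀ n a F, F.card = n → F.card < d → Set.EqOn g f (intCell a F) := by
      intro n
      induction n using Nat.strong_induction_on with
      | _ n ihn =>
        intro a F hn hF q hq
        by_cases hb : q ∈ intCellBdry a F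
        · obtain ⟨b, G, -, hG, hqG⟩ := exists_facet_of_mem_intCellBdry hb
          exact ihn _ (hn ▸ hG) b G rfl (hG.trans hF) hqG
        · have h : ¬ ∃ c : (J → ℤ) × Finset J, intCell c.1 c.2 ⊆ W ∧ c.2.card = d ∧
              q ∈ intCell c.1 c.2 \ intCellBdry c.1 c.2 := by
            rintro ⟨c, -, hcd, hc⟩
            obtain ⟨-, e⟩ := eq_of_mem_relInterior hc ⟨hq, hb⟩
            rw [e] at hcd; omega
          simp only [g, dif_neg h]
    refine ⟨g, fun a F hW hF => ?_⟩
    rcases Nat.lt_succ_iff_lt_or_eq.1 hF with hF | hF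
    · have := hg_low _ a F rfl hF
      exact ⟨(hf a F hW hF).1.congr this, hP a F f g this.symm (hf a F hW hF).2⟩
    · obtain ⟨e1, e2, e3⟩ := hE (a, F) hW hF
      have : Set.EqOn g (E (a, F)) (intCell a F) := by
        intro q hq
        by_cases hb : q ∈ intCellBdry a F
        · obtain ⟨b, G, -, hG, hqG⟩ := exists_facet_of_mem_intCellBdry hb
          rw [hg_low _ b G rfl (hF ▸ hG) hqG, e2 hb]
        · exact hg_int a F q hW hF ⟨hq, hb⟩
      exact ⟨e1.congr this, hP a F _ g this.symm e3⟩

/-- The radial coordinate of a cell and the projection from its centre. -/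
theorem exists_radial_projection (a : J → ℤ) {F : Finset J} (hF : F.Nonempty) :
    ∃ (ρ : (J → ℝ) → ℝ) (e : (J → ℝ) → J → ℝ), Continuous ρ ∧ Continuous e ∧
      (∀ q ∈ intCell a F, 0 ≤ ρ q ∧ ρ q ≤ 1) ∧
      (∀ q ∈ intCell a F, 1 / 2 ≤ ρ q → e q ∈ intCellBdry a F) ∧
      ∀ q ∈ intCellBdry a F, ρ q = 1 ∧ e q = q := by
  classical
  -- `ρ` is the sup distance to the centre, scaled to be 1 on the boundary. The maximum with 1/2 in
  -- `e` keeps the division continuous, so `e` is the true projection only on the outer shell.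
  let u : J → (J → ℝ) → ℝ := fun j q => |2 * (q j - a j) - 1|
  let ρ : (J → ℝ) → ℝ := fun q => F.sup' hF fun j => u j q
  let e : (J → ℝ) → J → ℝ := fun q j =>
    if j ∈ F then a j + 1 / 2 + (q j - a j - 1 / 2) / max (ρ q) (1 / 2) else a j
  have hu : ∀ j, Continuous (u j) := fun j => by fun_prop
  have hρ : Continuous ρ := Continuous.finset_sup'_apply hF fun j _ => hu j
  have hle : ∀ q, ∀ j ∈ F, u j q ≤ ρ q := fun q j hj => Finset.le_sup' (fun j => u j q) hj
  have hub : ∀ q ∈ intCell a F, ∀ j ∈ F, u j q ≤ 1 := by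
    intro q hq j hj
    obtain ⟨h1, h2⟩ := hq.1 j hj
    exact abs_le.2 ⟨by linarith, by linarith⟩
  have hρ1 : ∀ q ∈ intCell a F, ρ q ≤ 1 := fun q hq => Finset.sup'_le hF _ (hub q hq)
  refine ⟨ρ, e, hρ, ?_, fun q hq => ⟨?_, hρ1 q hq⟩, fun q hq hq2 => ?_, fun q hq => ?_⟩
  · refine continuous_pi fun j => ?_
    by_cases hj : j ∈ F
    · simp only [e, hj, if_true]
      refine continuous_const.add (Continuous.div (by fun_prop) (hρ.max continuous_const) ?_)
      intro q
      exact (lt_of_lt_of_le (by norm_num) (le_max_right _ _)).ne'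
    · simp only [e, hj, if_false]; exact continuous_const
  · obtain ⟨j, hj⟩ := hF
    exact (abs_nonneg _).trans (hle q j hj)
  · have hpos : 0 < ρ q := by linarith
    have hval : ∀ j ∈ F, e q j = a j + 1 / 2 + (q j - a j - 1 / 2) / ρ q := by
      intro j hj; simp only [e, hj, if_true, max_eq_left hq2]
    refine ⟨⟨fun j hj => ?_, fun j hj => by simp [e, hj]⟩, ?_⟩
    · rw [hval j hj]
      have := abs_le.1 (hle q j hj)
      have h1 : (q j - a j - 1 / 2) / ρ q ≤ 1 / 2 := by
        rw [div_le_iff₀ hpos]; linarith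
      have h2 : -(1 / 2) ≤ (q j - a j - 1 / 2) / ρ q := by
        rw [le_div_iff₀ hpos]; linarith
      constructor <;> linarith
    · obtain ⟨j, hj, hjs⟩ := Finset.exists_mem_eq_sup' hF fun j => u j q
      refine ⟨j, hj, ?_⟩
      rw [hval j hj]
      have hjs : ρ q = |2 * (q j - a j) - 1| := hjs
      rcases abs_choice (2 * (q j - a j) - 1) with h | h
      · right
        have : (q j - a j - 1 / 2) / ρ q = 1 / 2 := by
          rw [div_eq_iff hpos.ne']; linarith
        rw [this]; ring
      · left
        have : (q j - a j - 1 / 2) / ρ q = -(1 / 2) := by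
          rw [div_eq_iff hpos.ne']; linarith
        rw [this]; ring
  · have h1 : ρ q = 1 := by
      refine le_antisymm (hρ1 q hq.1) ?_
      obtain ⟨j, hj, h⟩ := hq.2
      refine le_trans (le_of_eq ?_) (hle q j hj)
      simp only [u]
      rcases h with h | h <;> rw [h] <;> norm_num
    refine ⟨h1, funext fun j => ?_⟩
    by_cases hj : j ∈ F
    · simp only [e, hj, if_true, h1]; norm_num
    · simp only [e, hj, if_false]; exact (hq.1.2 j hj).symm

end Cells

/-! ### Filling a cell by a null-homotopy. -/

theorem IsNullHomotopicIn.exists_homotopy {X : Type*} [TopologicalSpace X] {S T : Set X}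
    (h : IsNullHomotopicIn S T) :
    ∃ (c : X) (H : ℝ → X → X), c ∈ T ∧
      ContinuousOn (fun p : ℝ × X => H p.1 p.2) (Set.univ ×ˢ S) ∧
      (∀ x ∈ S, H 0 x = x) ∧ (∀ x ∈ S, H 1 x = c) ∧ ∀ t, ∀ x ∈ S, H t x ∈ T := by
  classical
  obtain ⟨hST, c, ⟨h⟩⟩ := h
  let G : ℝ → X → X := fun t x =>
    if hx : x ∈ S then (h (Set.projIcc 0 1 zero_le_one t, ⟨x, hx⟩) : T) else x
  have hG : ∀ t x (hx : x ∈ S), G t x = (h (Set.projIcc 0 1 zero_le_one t, ⟨x, hx⟩) : T) :=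
    fun t x hx => dif_pos hx
  refine ⟨c, G, c.2, ?_, fun x hx => ?_, fun x hx => ?_, fun t x hx => ?_⟩
  · rw [continuousOn_iff_continuous_domRestrict]
    have : (Set.univ ×ˢ S).domRestrict (fun p : ℝ × X => G p.1 p.2) = fun p =>
        ((h (Set.projIcc 0 1 zero_le_one p.1.1, ⟨p.1.2, p.2.2⟩) : T) : X) := by
      ext p; exact hG _ _ p.2.2
    rw [this]
    refine continuous_subtype_val.comp (h.continuous.comp (Continuous.prodMk ?_ ?_))
    · exact continuous_projIcc.comp (continuous_fst.comp continuous_subtype_val)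
    · exact (continuous_snd.comp continuous_subtype_val).subtype_mk _
  · rw [hG _ _ hx, Set.projIcc_left]
    exact congrArg Subtype.val (h.apply_zero ⟨x, hx⟩)
  · rw [hG _ _ hx, Set.projIcc_right]
    exact congrArg Subtype.val (h.apply_one ⟨x, hx⟩)
  · rw [hG _ _ hx]; exact Subtype.coe_prop _

/-- A map from the boundary of a cell to `S` extends to a map from the cell to `T`. -/
theorem IsNullHomotopicIn.exists_extension {X J : Type*} [TopologicalSpace X] {S T : Set X}
    (h : IsNullHomotopicIn S T) {a : J → ℤ} {F : Finset J} (hF : F.Nonempty)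
    {f : (J → ℝ) → X} (hf : ContinuousOn f (intCellBdry a F))
    (hfS : Set.MapsTo f (intCellBdry a F) S) :
    ∃ f', ContinuousOn f' (intCell a F) ∧ Set.EqOn f' f (intCellBdry a F) ∧
      Set.MapsTo f' (intCell a F) T := by
  classical
  obtain ⟨ρ, e, hρ, he, hρ01, heb, hb⟩ := exists_radial_projection a hF
  obtain ⟨c, H, hcT, hH, hH0, hH1, hHT⟩ := h.exists_homotopy
  -- The inner half goes to the end point of the null-homotopy; the outer shell runs through it,
  -- from time 0 on the boundary to time 1 at radius 1/2.
  let g : (J → ℝ) → X := fun q => if ρ q ≤ 1 / 2 then c else H (2 - 2 * ρ q) (f (e q))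
  have hA : Set.EqOn g (fun _ => c) (intCell a F ∩ {q | ρ q ≤ 1 / 2}) := fun q hq => if_pos hq.2
  have hB : Set.EqOn g (fun q => H (2 - 2 * ρ q) (f (e q))) (intCell a F ∩ {q | 1 / 2 ≤ ρ q}) := by
    rintro q ⟨hq, hq2⟩
    by_cases hc : ρ q ≤ 1 / 2
    · have : ρ q = 1 / 2 := le_antisymm hc hq2
      simp only [g, if_pos hc]
      rw [this, show (2 : ℝ) - 2 * (1 / 2) = 1 by norm_num, hH1 _ (hfS (heb q hq hq2))]
    · simp only [g, if_neg hc]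
  refine ⟨g, ?_, fun q hq => ?_, fun q hq => ?_⟩
  · have hcov : intCell a F = (intCell a F ∩ {q | ρ q ≤ 1 / 2}) ∪
        (intCell a F ∩ {q | 1 / 2 ≤ ρ q}) := by
      rw [← Set.inter_union_distrib_left, eq_comm, Set.inter_eq_left]
      exact fun q _ => le_total (ρ q) (1 / 2)
    rw [hcov]
    refine ContinuousOn.union_of_isClosed (continuousOn_const.congr hA) (ContinuousOn.congr ?_ hB)
      ((isClosed_intCell a F).inter (isClosed_le hρ continuous_const))
      ((isClosed_intCell a F).inter (isClosed_le continuous_const hρ))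
    refine hH.comp (f := fun q => (2 - 2 * ρ q, f (e q))) (ContinuousOn.prodMk ?_ ?_) ?_
    · exact Continuous.continuousOn (by fun_prop)
    · exact hf.comp he.continuousOn fun q hq => heb q hq.1 hq.2
    · exact fun q hq => ⟨trivial, hfS (heb q hq.1 hq.2)⟩
  · obtain ⟨h1, h2⟩ := hb q hq
    rw [hB ⟨hq.1, by rw [Set.mem_ofPred_eq, h1]; norm_num⟩]
    simp only [h1, h2]
    rw [show (2 : ℝ) - 2 * 1 = 0 by norm_num, hH0 _ (hfS hq)]
  · rcases le_total (ρ q) (1 / 2) with h1 | h1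
    · rw [hA ⟨hq, h1⟩]; exact hcT
    · rw [hB ⟨hq, h1⟩]; exact hHT _ _ (hfS (heb q hq h1))

/-! ### Coarse coning in hyperbolic length spaces. -/

section Hyperbolic

variable {X : Type*} [MetricSpace X]

/-- The intermediate value theorem along an almost shortest path gives the distance from `x`;
additivity of length bounds the sum. -/
theorem IsLengthMetric.exists_dist_eq (hlen : IsLengthMetric X) (x y : X) {ε s : ℝ} (hε : 0 < ε)
    (hs0 : 0 ≤ s) (hs1 : s ≤ 1) :
    ∃ z, dist x z = s * dist x y ∧ dist x z + dist z y ≤ dist x y + ε := by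
  obtain ⟨γ, hγ⟩ := hlen x y ε hε
  have hc : Continuous fun t => dist x (γ t) := continuous_const.dist γ.continuous
  have hmem : s * dist x y ∈ Set.Icc (dist x (γ 0)) (dist x (γ 1)) := by
    simp only [γ.source, γ.target, dist_self]
    exact ⟨by positivity, mul_le_of_le_one_left dist_nonneg hs1⟩
  obtain ⟨t, -, ht⟩ := intermediate_value_Icc (zero_le_one' unitInterval) hc.continuousOn hmem
  refine ⟨γ t, ht, ?_⟩
  have h1 : edist x (γ t) + edist (γ t) y ≤ eVariationOn γ Set.univ := by
    have hsub : eVariationOn γ (Set.Iic t) + eVariationOn γ (Set.Ici t) ≤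
        eVariationOn γ (Set.Iic t ∪ Set.Ici t) :=
      eVariationOn.add_le_union γ fun a ha b hb => le_trans ha hb
    have e1 : edist (γ 0) (γ t) ≤ eVariationOn γ (Set.Iic t) :=
      eVariationOn.edist_le γ unitInterval.nonneg' (Set.mem_Iic.2 le_rfl)
    have e2 : edist (γ t) (γ 1) ≤ eVariationOn γ (Set.Ici t) :=
      eVariationOn.edist_le γ (Set.mem_Ici.2 le_rfl) unitInterval.le_one'
    rw [γ.source] at e1
    rw [γ.target] at e2
    exact (add_le_add e1 e2).trans (hsub.trans (eVariationOn.mono γ (Set.subset_univ _)))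
  have h2 := h1.trans hγ
  rw [edist_dist, edist_dist, ← ENNReal.ofReal_add dist_nonneg dist_nonneg] at h2
  exact (ENNReal.ofReal_le_ofReal_iff (by positivity)).1 h2

/-- Points on almost geodesics from `x` to neighbouring points `y` and `y'`. -/
theorem IsGromovHyperbolic.dist_le {δ : ℝ} (hhyp : IsGromovHyperbolic X δ) (hδ : 0 ≤ δ)
    {x y y' z z' : X} {ε : ℝ} (hε : 0 ≤ ε) (hz : dist x z + dist z y ≤ dist x y + ε)
    (hz' : dist x z' + dist z' y' ≤ dist x y' + ε) :
    dist z z' ≤ |dist x z - dist x z'| + 2 * ε + 2 * dist y y' + 4 * δ := by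
  -- The four point condition is used along the chain z, y, y', z': two losses of δ in Gromov
  -- products, doubled on passing to distances, give 4δ.
  have h1 := hhyp z y y' x
  have h2 := hhyp z y' z' x
  simp only [gromovProduct] at h1 h2
  rw [dist_comm y' z'] at h2
  have t1 := dist_triangle x y y'
  have t2 := dist_triangle x y' y
  rw [dist_comm y' y] at t2
  have p1 : 0 ≤ dist z y := dist_nonneg
  have p2 : 0 ≤ dist z' y' := dist_nonneg
  have p3 : 0 ≤ dist y y' := dist_nonneg
  have a1 := le_abs_self (dist x z - dist x z')
  have a2 := neg_abs_le (dist x z - dist x z')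
  rcases min_choice ((dist x z + dist x y - dist z y) / 2) ((dist x y + dist x y' - dist y y') / 2)
    with m1 | m1 <;>
  rcases min_choice ((dist x z + dist x y' - dist z y') / 2)
    ((dist x y' + dist x z' - dist z' y') / 2) with m2 | m2 <;>
  rw [m1] at h1 <;> rw [m2] at h2 <;> linarith

theorem isCompact_unitCell (J : Type*) [Fintype J] :
    IsCompact (intCell (0 : J → ℤ) Finset.univ) :=
  (isCompact_Icc (a := (0 : J → ℝ)) (b := 1)).of_isClosed_subset (isClosed_intCell _ _) fun q hq =>
    ⟨fun j => by simpa using (hq.1 j (Finset.mem_univ j)).1,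
      fun j => by simpa using (hq.1 j (Finset.mem_univ j)).2⟩

theorem isClosed_intCellBdry {J : Type*} (a : J → ℤ) (F : Finset J) :
    IsClosed (intCellBdry a F) := by
  have : intCellBdry a F = intCell a F ∩ ⋃ j : F, {q : J → ℝ | q j = a j ∨ q j = a j + 1} := by
    ext q; simp [intCellBdry]
  rw [this]
  refine (isClosed_intCell a F).inter (isClosed_iUnion_of_finite fun j => ?_)
  exact (isClosed_eq (continuous_apply _) continuous_const).union
    (isClosed_eq (continuous_apply _) continuous_const)

/-- A map from the boundary of a cube to a hyperbolic length space extends to the cube so that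
nearby points have images at distance less than `4 * δ + η`. -/
theorem IsGromovHyperbolic.exists_coarse_extension {δ : ℝ} (hhyp : IsGromovHyperbolic X δ)
    (hδ : 0 ≤ δ) (hlen : IsLengthMetric X) {J : Type*} [Fintype J] [Nonempty J]
    {f : (J → ℝ) → X} (hf : ContinuousOn f (intCellBdry (0 : J → ℤ) Finset.univ)) {η : ℝ}
    (hη : 0 < η) :
    ∃ g : (J → ℝ) → X, Set.EqOn g f (intCellBdry (0 : J → ℤ) Finset.univ) ∧
      ∃ τ > 0, ∀ p ∈ intCell (0 : J → ℤ) Finset.univ, ∀ q ∈ intCell (0 : J → ℤ) Finset.univ,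
        dist p q < τ → dist (g p) (g q) < 4 * δ + η := by
  classical
  obtain ⟨ρ, e, hρ, he, hρ01, heb, hb⟩ :=
    exists_radial_projection (0 : J → ℤ) (Finset.univ_nonempty (α := J))
  set Q := intCell (0 : J → ℤ) Finset.univ with hQ
  let x₀ : X := f 0
  -- At s = 1 the point is taken to be `y` itself, so that the cone agrees with `f` on the boundary
  -- exactly.
  have hz : ∀ (y : X) (s : ℝ), ∃ z, 0 ≤ s → s ≤ 1 →
      dist x₀ z = s * dist x₀ y ∧ dist x₀ z + dist z y ≤ dist x₀ y + η / 16 ∧ (s = 1 → z = y) := by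
    intro y s
    by_cases h : s = 1
    · exact ⟨y, fun _ _ => ⟨by rw [h, one_mul], by rw [dist_self]; linarith, fun _ => rfl⟩⟩
    · by_cases hs : 0 ≤ s ∧ s ≤ 1
      · obtain ⟨z, h1, h2⟩ := hlen.exists_dist_eq x₀ y (ε := η / 16) (by positivity) hs.1 hs.2
        exact ⟨z, fun _ _ => ⟨h1, h2, fun h' => absurd h' h⟩⟩
      · exact ⟨y, fun h1 h2 => absurd ⟨h1, h2⟩ hs⟩
  choose z hz using hz
  let g : (J → ℝ) → X := fun q => if ρ q ≤ 1 / 2 then x₀ else z (f (e q)) (2 * ρ q - 1)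
  have hQc : IsCompact Q := isCompact_unitCell J
  have hAc : IsCompact (Q ∩ {q | 1 / 2 ≤ ρ q}) :=
    hQc.inter_right (isClosed_le continuous_const hρ)
  have hfe : ContinuousOn (fun q => f (e q)) (Q ∩ {q | 1 / 2 ≤ ρ q}) :=
    hf.comp he.continuousOn fun q hq => heb q hq.1 hq.2
  obtain ⟨M, hM⟩ : ∃ M, ∀ q ∈ Q ∩ {q | 1 / 2 ≤ ρ q}, dist x₀ (f (e q)) ≤ M := by
    obtain ⟨M, hM⟩ := (hAc.image_of_continuousOn hfe).isBounded.subset_closedBall x₀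
    exact ⟨M, fun q hq => by rw [dist_comm]; exact hM ⟨q, hq, rfl⟩⟩
  -- With tolerance η/16 for `f ∘ e` and for the effect of `ρ`, the total error beyond 4δ is at most
  -- 6η/16. The constant 32(|M| + 1) compensates the cone height, which is at most `M`.
  obtain ⟨τ₁, hτ₁, h₁⟩ := Metric.uniformContinuousOn_iff.1
    (hAc.uniformContinuousOn_of_continuous hfe) (η / 16) (by positivity)
  obtain ⟨τ₂, hτ₂, h₂⟩ := Metric.uniformContinuousOn_iff.1
    (hQc.uniformContinuousOn_of_continuous hρ.continuousOn) (η / (32 * (|M| + 1))) (by positivity)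
  have hκ : ∀ κ y : ℝ, 0 ≤ κ → κ < η / (32 * (|M| + 1)) → 0 ≤ y → y ≤ M →
      2 * κ * y ≤ η / 16 := by
    intro κ y hκ0 hκ hy0 hy
    rw [lt_div_iff₀ (by positivity)] at hκ
    have : κ * y ≤ κ * (|M| + 1) :=
      mul_le_mul_of_nonneg_left (hy.trans ((le_abs_self M).trans (by linarith))) hκ0
    linarith
  refine ⟨g, fun q hq => ?_, min τ₁ τ₂, lt_min hτ₁ hτ₂, ?_⟩
  · obtain ⟨r1, r2⟩ := hb q hq
    have : ¬ (ρ q ≤ 1 / 2) := by rw [r1]; norm_num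
    simp only [g, if_neg this, r1, r2]
    exact (hz (f q) (2 * 1 - 1) (by norm_num) (by norm_num)).2.2 (by norm_num)
  have mixed : ∀ p ∈ Q, ∀ q ∈ Q, dist p q < τ₂ → ρ p ≤ 1 / 2 → ¬ (ρ q ≤ 1 / 2) →
      dist x₀ (z (f (e q)) (2 * ρ q - 1)) < 4 * δ + η := by
    intro p hp q hq hpq h1 h2
    have h3 := h₂ p hp q hq hpq
    push Not at h2
    rw [Real.dist_eq, abs_lt] at h3
    have h4 := (hρ01 q hq).2
    rw [(hz (f (e q)) (2 * ρ q - 1) (by linarith) (by linarith)).1]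
    have := hκ (ρ q - 1 / 2) (dist x₀ (f (e q))) (by linarith) (by linarith) dist_nonneg
      (hM q ⟨hq, h2.le⟩)
    linarith
  intro p hp q hq hpq
  have hpq1 := lt_of_lt_of_le hpq (min_le_left _ _)
  have hpq2 := lt_of_lt_of_le hpq (min_le_right _ _)
  by_cases h1 : ρ p ≤ 1 / 2 <;> by_cases h2 : ρ q ≤ 1 / 2
  · simp only [g, if_pos h1, if_pos h2, dist_self]; linarith
  · simp only [g, if_pos h1, if_neg h2]
    exact mixed p hp q hq hpq2 h1 h2
  · simp only [g, if_neg h1, if_pos h2]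
    rw [dist_comm]
    exact mixed q hq p hp (by rwa [dist_comm]) h2 h1
  · simp only [g, if_neg h1, if_neg h2]
    push Not at h1 h2
    have hd := h₁ p ⟨hp, h1.le⟩ q ⟨hq, h2.le⟩ hpq1
    have h3 := h₂ p hp q hq hpq2
    have hp1 := (hρ01 p hp).2
    have hq1 := (hρ01 q hq).2
    obtain ⟨a1, a2, -⟩ := hz (f (e p)) (2 * ρ p - 1) (by linarith) (by linarith)
    obtain ⟨b1, b2, -⟩ := hz (f (e q)) (2 * ρ q - 1) (by linarith) (by linarith)
    have key := hhyp.dist_le hδ (by positivity) a2 b2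
    have e1 : |dist x₀ (z (f (e p)) (2 * ρ p - 1)) - dist x₀ (z (f (e q)) (2 * ρ q - 1))| ≤
        η / 16 + η / 16 := by
      rw [a1, b1]
      have : (2 * ρ p - 1) * dist x₀ (f (e p)) - (2 * ρ q - 1) * dist x₀ (f (e q)) =
        2 * (ρ p - ρ q) * dist x₀ (f (e p)) +
          (2 * ρ q - 1) * (dist x₀ (f (e p)) - dist x₀ (f (e q))) := by ring
      rw [this]
      refine (abs_add_le _ _).trans (add_le_add ?_ ?_)
      · rw [abs_mul, abs_mul, abs_two, abs_of_nonneg (dist_nonneg (x := x₀) (y := f (e p)))]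
        exact hκ _ _ (abs_nonneg _) (by rwa [Real.dist_eq] at h3) dist_nonneg (hM p ⟨hp, h1.le⟩)
      · rw [abs_mul, abs_of_nonneg (by linarith : 0 ≤ 2 * ρ q - 1)]
        have := abs_dist_sub_le (f (e p)) (f (e q)) x₀
        rw [dist_comm _ x₀, dist_comm _ x₀] at this
        nlinarith [abs_nonneg (dist x₀ (f (e p)) - dist x₀ (f (e q)))]
    linarith

end Hyperbolic

/-! ### From coarse to continuous fillings of cubes. -/

section Hyperbolic

variable {X : Type*} [MetricSpace X]

/-- Maps from the boundary of a unit cube of dimension at most `n + 1` extend to the cube. -/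
theorem IsGromovHyperbolic.exists_cube_extension {δ : ℝ} (hhyp : IsGromovHyperbolic X δ)
    (hδ : 0 < δ) (hlen : IsLengthMetric X) {n : ℕ}
    (hball : ∀ r : ℝ, 0 < r → r ≤ 8 * ((n : ℝ) + 1) * δ →
      ∀ x : X, IsNullHomotopicIn (Metric.ball x r) (Metric.ball x (r + 4 * δ)))
    {J : Type*} [Fintype J] [Nonempty J] (hJ : Fintype.card J ≤ n + 1) {f : (J → ℝ) → X}
    (hf : ContinuousOn f (intCellBdry (0 : J → ℤ) Finset.univ)) :
    ∃ f' : (J → ℝ) → X, ContinuousOn f' (intCell (0 : J → ℤ) Finset.univ) ∧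
      Set.EqOn f' f (intCellBdry (0 : J → ℤ) Finset.univ) := by
  classical
  have : Nonempty X := ⟨f 0⟩
  -- The largest radius used below is at most n(8δ + η) + 4δ + 2η, which this choice makes equal to
  -- 8(n + 1)δ.
  set η : ℝ := 4 * δ / (n + 2) with hηdef
  have hη : 0 < η := by positivity
  have hηn : ((n : ℝ) + 2) * η = 4 * δ := by rw [hηdef]; field_simp
  obtain ⟨g, hgf, τ₁, hτ₁, hg⟩ := hhyp.exists_coarse_extension hδ.le hlen hf hη
  set Q := intCell (0 : J → ℤ) Finset.univ with hQdef
  set B := intCellBdry (0 : J → ℤ) Finset.univ with hBdef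
  have hBc : IsCompact B :=
    (isCompact_unitCell J).of_isClosed_subset (isClosed_intCellBdry _ _) (intCellBdry_subset _ _)
  obtain ⟨τ₂, hτ₂, hfu⟩ := Metric.uniformContinuousOn_iff.1
    (hBc.uniformContinuousOn_of_continuous hf) η hη
  obtain ⟨N, hN⟩ := exists_nat_one_div_lt (lt_min hτ₁ hτ₂)
  set L : ℝ := (N : ℝ) + 1 with hL
  have hL0 : 0 < L := by positivity
  let sc : (J → ℝ) → J → ℝ := fun q j => q j / L
  have hsc : Continuous sc := by fun_prop
  have hscd : ∀ a F, ∀ p ∈ intCell a F, ∀ q ∈ intCell a F, dist (sc p) (sc q) < min τ₁ τ₂ := by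
    intro a F p hp q hq
    refine lt_of_le_of_lt ((dist_pi_le_iff (by positivity)).2 fun j => ?_) hN
    simp only [sc]
    rw [Real.dist_eq, ← sub_div, abs_div, abs_of_pos hL0]
    refine div_le_div_of_nonneg_right ?_ hL0.le
    by_cases hj : j ∈ F
    · have h1 := hp.1 j hj
      have h2 := hq.1 j hj
      exact abs_le.2 ⟨by linarith, by linarith⟩
    · rw [hp.2 j hj, hq.2 j hj]; simp
  let W : Set (J → ℝ) := {q | ∀ j, 0 ≤ q j ∧ q j ≤ L}
  let D : Set (J → ℝ) := {q | q ∈ W ∧ ∃ j, q j = 0 ∨ q j = L}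
  have hWQ : ∀ q ∈ W, sc q ∈ Q := by
    intro q hq
    refine ⟨fun j _ => ?_, fun j hj => absurd (Finset.mem_univ j) hj⟩
    simp only [sc, Pi.zero_apply, Int.cast_zero, zero_add]
    exact ⟨div_nonneg (hq j).1 hL0.le, (div_le_one hL0).2 (hq j).2⟩
  have hDB : ∀ q ∈ D, sc q ∈ B := by
    rintro q ⟨hq, j, hj⟩
    refine ⟨hWQ q hq, j, Finset.mem_univ j, ?_⟩
    simp only [sc, Pi.zero_apply, Int.cast_zero, zero_add]
    rcases hj with hj | hj <;> rw [hj]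
    · left; simp
    · right; exact div_self hL0.ne'
  let base : (J → ℤ) → J → ℝ := fun a j => a j
  have hbase : ∀ a F, base a ∈ intCell a F := fun a F => base_mem_intCell a F
  -- Boundary cells keep `f`. Elsewhere each dimension adds 4δ + η for passing from the base vertex
  -- of a face to that of the cell, and 4δ for the larger ball of the null-homotopy.
  let P : (J → ℤ) → Finset J → ((J → ℝ) → X) → Prop := fun a F f' =>
    (intCell a F ⊆ D → Set.EqOn f' (fun q => f (sc q)) (intCell a F)) ∧
      ∀ q ∈ intCell a F, dist (f' q) (g (sc (base a))) < F.card * (8 * δ + η) + η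
  obtain ⟨F', hF'⟩ : ∃ f' : (J → ℝ) → X, ∀ a F, intCell a F ⊆ W → F.card < Fintype.card J + 1 →
      ContinuousOn f' (intCell a F) ∧ P a F f' := by
    refine exists_skeletal_extension W P ?_ ?_ _
    · intro a F f g hfg hPf
      exact ⟨fun h q hq => by rw [← hfg hq, hPf.1 h hq], fun q hq => by
        rw [← hfg hq]; exact hPf.2 q hq⟩
    · intro a F f₁ hW hf₁ hP
      by_cases hD : intCell a F ⊆ D
      · refine ⟨fun q => f (sc q), hf.comp hsc.continuousOn fun q hq => hDB q (hD hq), ?_,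
          fun _ _ _ => rfl, ?_⟩
        · intro q hq
          obtain ⟨b, G, hb, hG, hqG⟩ := exists_facet_of_mem_intCellBdry hq
          exact ((hP b G hb hG).1 ((hb.trans (intCellBdry_subset a F)).trans hD) hqG).symm
        · intro q hq
          have h1 := hDB _ (hD hq)
          have h2 := hDB _ (hD (hbase a F))
          rw [hgf h2]
          have := hfu _ h1 _ h2
            (lt_of_lt_of_le (hscd a F _ hq _ (hbase a F)) (min_le_right _ _))
          have : 0 ≤ (F.card : ℝ) * (8 * δ + η) := by positivity
          linarith
      · rcases F.eq_empty_or_nonempty with rfl | hFne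
        · refine ⟨fun _ => g (sc (base a)), continuousOn_const, ?_, fun h => absurd h hD, ?_⟩
          · rintro q ⟨-, j, hj, -⟩
            simp at hj
          · intro q _
            simpa using hη
        · have hcard : ((F.card : ℝ) - 1) ≤ n := by
            have : F.card ≤ n + 1 := (Finset.card_le_univ F).trans hJ
            have : (F.card : ℝ) ≤ n + 1 := by exact_mod_cast this
            linarith
          have hcard1 : (1 : ℝ) ≤ F.card := by exact_mod_cast hFne.card_pos
          set r : ℝ := (F.card - 1) * (8 * δ + η) + η + (4 * δ + η) with hr
          have hr0 : 0 < r := by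
            have : 0 ≤ ((F.card : ℝ) - 1) * (8 * δ + η) :=
              mul_nonneg (by linarith) (by positivity)
            linarith
          have hr1 : r ≤ 8 * ((n : ℝ) + 1) * δ := by
            have : ((F.card : ℝ) - 1) * (8 * δ + η) ≤ n * (8 * δ + η) :=
              mul_le_mul_of_nonneg_right hcard (by positivity)
            nlinarith
          obtain ⟨f', h1, h2, h3⟩ :=
            (hball r hr0 hr1 (g (sc (base a)))).exists_extension hFne hf₁ (by
              intro q hq
              obtain ⟨b, G, hb, hG, hqG⟩ := exists_facet_of_mem_intCellBdry hq
              have d1 := (hP b G hb hG).2 q hqG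
              have hbF := (intCellBdry_subset a F) (hb (hbase b G))
              have d2 := hg _ (hWQ _ (hW hbF)) _ (hWQ _ (hW (hbase a F)))
                (lt_of_lt_of_le (hscd a F _ hbF _ (hbase a F)) (min_le_left _ _))
              have hGc : (G.card : ℝ) ≤ F.card - 1 := by
                have : (G.card : ℝ) + 1 ≤ F.card := by exact_mod_cast hG
                linarith
              have d3 : (G.card : ℝ) * (8 * δ + η) ≤ (F.card - 1) * (8 * δ + η) :=
                mul_le_mul_of_nonneg_right hGc (by positivity)
              rw [Metric.mem_ball]
              linarith [dist_triangle (f₁ q) (g (sc (base b))) (g (sc (base a)))])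
          refine ⟨f', h1, h2, fun h => absurd h hD, fun q hq => ?_⟩
          have := h3 hq
          rw [Metric.mem_ball] at this
          linarith
  have hcontW : ContinuousOn F' W := by
    have hsub : W ⊆ ⋃ a : J → Fin (N + 1), intCell (fun j => ((a j : ℕ) : ℤ)) Finset.univ := by
      intro q hq
      -- The minimum puts a coordinate equal to `L` in the last cell instead of one beyond the cube.
      refine Set.mem_iUnion.2 ⟨fun j => ⟨min N ⌊q j⌋₊, by omega⟩, fun j _ => ?_,
        fun j hj => absurd (Finset.mem_univ j) hj⟩
      simp only [Int.cast_natCast]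
      have h1 := Nat.floor_le (hq j).1
      have h2 := Nat.lt_floor_add_one (q j)
      have h3 := (hq j).2
      rcases le_total N ⌊q j⌋₊ with h | h
      · rw [min_eq_left h]
        have : (N : ℝ) ≤ (⌊q j⌋₊ : ℝ) := by exact_mod_cast h
        exact ⟨this.trans h1, h3⟩
      · rw [min_eq_right h]; exact ⟨h1, h2.le⟩
    refine ContinuousOn.mono ?_ hsub
    refine (locallyFinite_of_finite _).continuousOn_iUnion (fun _ => isClosed_intCell _ _)
      fun a => (hF' _ _ ?_ (Nat.lt_succ_of_le (Finset.card_le_univ _))).1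
    intro q hq j
    obtain ⟨h1, h2⟩ := hq.1 j (Finset.mem_univ j)
    simp only [Int.cast_natCast] at h1 h2
    have : ((a j : ℕ) : ℝ) ≤ N := by exact_mod_cast Nat.lt_succ_iff.1 (a j).2
    exact ⟨le_trans (Nat.cast_nonneg _) h1, h2.trans (by linarith)⟩
  have hQW : ∀ q ∈ Q, (fun j => L * q j) ∈ W := by
    intro q hq j
    have := hq.1 j (Finset.mem_univ j)
    simp only [Pi.zero_apply, Int.cast_zero, zero_add] at this
    exact ⟨mul_nonneg hL0.le this.1, mul_le_of_le_one_right hL0.le this.2⟩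
  have hmul : Continuous fun (q : J → ℝ) j => L * q j := by fun_prop
  refine ⟨fun q => F' fun j => L * q j, hcontW.comp hmul.continuousOn hQW, fun q hq => ?_⟩
  have hs : sc (fun j => L * q j) = q := by
    funext j; simp only [sc]; field_simp
  set p : J → ℝ := fun j => L * q j with hp
  have hpW := hQW q hq.1
  have hpD : p ∈ D := by
    refine ⟨hpW, ?_⟩
    obtain ⟨j, -, h⟩ := hq.2
    rcases h with h | h
    · exact ⟨j, Or.inl (by simp [hp, h])⟩
    · exact ⟨j, Or.inr (by simp [hp, h])⟩
  -- The cell with `p` in its relative interior: a coordinate of `p` equal to 0 or `L` is an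
  -- integer, hence not free, so the whole cell lies in `D`, where `P` prescribes `f`.
  let a : J → ℤ := fun j => ⌊p j⌋
  let F : Finset J := Finset.univ.filter fun j => p j ≠ ⌊p j⌋
  have hpc : p ∈ intCell a F := by
    refine ⟨fun j _ => ⟨Int.floor_le _, (Int.lt_floor_add_one _).le⟩, fun j hj => ?_⟩
    simpa [F] using hj
  have hLint : L = ((N + 1 : ℤ) : ℝ) := by simp [hL]
  have hcW : intCell a F ⊆ W := by
    intro u hu j
    have h0 : 0 ≤ a j := Int.floor_nonneg.2 (hpW j).1
    have h0' : (0 : ℝ) ≤ a j := by exact_mod_cast h0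
    by_cases hj : j ∈ F
    · have hne : p j ≠ a j := by simpa [F] using hj
      have hlt : (a j : ℝ) < p j := lt_of_le_of_ne (Int.floor_le _) hne.symm
      have h1 := hlt.trans_le (hpW j).2
      rw [hLint] at h1
      have h2 : a j + 1 ≤ N + 1 := by exact_mod_cast h1
      have h3 : (a j : ℝ) + 1 ≤ L := by rw [hLint]; exact_mod_cast h2
      exact ⟨h0'.trans (hu.1 j hj).1, (hu.1 j hj).2.trans h3⟩
    · rw [hu.2 j hj, ← hpc.2 j hj]; exact hpW j
  have hcD : intCell a F ⊆ D := by
    intro u hu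
    refine ⟨hcW hu, ?_⟩
    obtain ⟨-, j, h⟩ := hpD
    have hj : j ∉ F := by
      simp only [F, Finset.mem_filter, Finset.mem_univ, true_and, not_not]
      rcases h with h | h
      · rw [h]; simp
      · rw [h, hLint, Int.floor_intCast]
    refine ⟨j, ?_⟩
    rwa [hu.2 j hj, ← hpc.2 j hj]
  have := (hF' a F hcW (Nat.lt_succ_of_le (Finset.card_le_univ _))).2.1 hcD hpc
  exact this.trans (congrArg f hs)

/-- Maps from the boundary of a cell of dimension at most `n + 1` extend to the cell. -/
theorem IsGromovHyperbolic.exists_cell_extension {δ : ℝ} (hhyp : IsGromovHyperbolic X δ)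
    (hδ : 0 < δ) (hlen : IsLengthMetric X) {n : ℕ}
    (hball : ∀ r : ℝ, 0 < r → r ≤ 8 * ((n : ℝ) + 1) * δ →
      ∀ x : X, IsNullHomotopicIn (Metric.ball x r) (Metric.ball x (r + 4 * δ)))
    {J : Type*} (a : J → ℤ) {F : Finset J} (hF : F.Nonempty) (hcard : F.card ≤ n + 1)
    {f : (J → ℝ) → X} (hf : ContinuousOn f (intCellBdry a F)) :
    ∃ f' : (J → ℝ) → X, ContinuousOn f' (intCell a F) ∧ Set.EqOn f' f (intCellBdry a F) := by
  classical
  have : Nonempty F := hF.to_subtype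
  let emb : (F → ℝ) → J → ℝ := fun u j => if h : j ∈ F then a j + u ⟨j, h⟩ else a j
  let res : (J → ℝ) → F → ℝ := fun q i => q i - a i
  have hemb : Continuous emb := by
    refine continuous_pi fun j => ?_
    by_cases h : j ∈ F
    · simp only [emb, h, dif_pos]; fun_prop
    · simp only [emb, h, dif_neg, not_false_eq_true]; fun_prop
  have hres : Continuous res := by fun_prop
  have hmemb : ∀ u ∈ intCell (0 : F → ℤ) Finset.univ, emb u ∈ intCell a F := by
    intro u hu
    refine ⟨fun j hj => ?_, fun j hj => by simp [emb, hj]⟩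
    have := hu.1 ⟨j, hj⟩ (Finset.mem_univ _)
    simp only [Pi.zero_apply, Int.cast_zero, zero_add] at this
    simp only [emb, hj, dif_pos]
    constructor <;> linarith
  have hmres : ∀ q ∈ intCell a F, res q ∈ intCell (0 : F → ℤ) Finset.univ := by
    intro q hq
    refine ⟨fun j _ => ?_, fun j hj => absurd (Finset.mem_univ j) hj⟩
    have := hq.1 j j.2
    simp only [res, Pi.zero_apply, Int.cast_zero, zero_add]
    constructor <;> linarith
  have hmb : Set.MapsTo emb (intCellBdry (0 : F → ℤ) Finset.univ) (intCellBdry a F) := by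
    rintro u ⟨hu, j, -, hj⟩
    refine ⟨hmemb u hu, j, j.2, ?_⟩
    simpa [emb] using hj
  have her : ∀ q ∈ intCell a F, emb (res q) = q := by
    intro q hq
    funext j
    by_cases h : j ∈ F
    · simp [emb, res, h]
    · simp [emb, h, hq.2 j h]
  obtain ⟨f', h1, h2⟩ := hhyp.exists_cube_extension hδ hlen hball
    (by rwa [Fintype.card_coe]) (hf.comp hemb.continuousOn hmb)
  refine ⟨fun q => f' (res q), h1.comp hres.continuousOn hmres, fun q hq => ?_⟩
  have hb : res q ∈ intCellBdry (0 : F → ℤ) Finset.univ := by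
    obtain ⟨hq, j, hj, h⟩ := hq
    refine ⟨hmres q hq, ⟨j, hj⟩, Finset.mem_univ _, ?_⟩
    rcases h with h | h <;> simp [res, h]
  simp only [h2 hb, Function.comp_apply, her q hq.1]

end Hyperbolic

/-! ### The cubical structure of a simplicial complex and its cylinder. -/

namespace AbstractSimplicialComplex

variable {ι : Type*} (K : AbstractSimplicialComplex ι)

theorem sum_le_one_of_mem_realization {K : AbstractSimplicialComplex ι} {p : ι → ℝ}
    (hp : p ∈ K.realization) (S : Finset ι) : ∑ v ∈ S, p v ≤ 1 := by
  classical
  obtain ⟨h0, s, -, hs, hsum⟩ := hp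
  calc ∑ v ∈ S, p v ≤ ∑ v ∈ S ∪ s, p v :=
        Finset.sum_le_sum_of_subset_of_nonneg Finset.subset_union_left fun v _ _ => h0 v
    _ = ∑ v ∈ s, p v :=
        (Finset.sum_subset Finset.subset_union_right fun v _ hv => hs v hv).symm
    _ = 1 := hsum

/-- The realization in coordinates normalized to have maximum `1`, which makes it a cubical
complex. -/
def cubicalRealization : Set (ι → ℝ) :=
  {q | (∀ v, 0 ≤ q v ∧ q v ≤ 1) ∧ (∃ v, q v = 1) ∧ ∃ s ∈ K.faces, ∀ v ∉ s, q v = 0}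

/-- The product of an interval, in the coordinate `none`, with `cubicalRealization`. -/
def cubicalCylinder : Set (Option ι → ℝ) :=
  {q | (0 ≤ q none ∧ q none ≤ 1) ∧ (fun v => q (some v)) ∈ K.cubicalRealization}

/-- The point with barycentric coordinates proportional to `q`. -/
noncomputable def barycentric (q : ι → ℝ) (v : ι) : ℝ := q v / ∑ᶠ w, q w

variable {K}

theorem finsum_eq_sum_of_forall_notMem {q : ι → ℝ} {s : Finset ι} (h : ∀ v ∉ s, q v = 0) :
    ∑ᶠ w, q w = ∑ w ∈ s, q w :=
  finsum_eq_sum_of_support_subset _ fun v hv => by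
    by_contra hc; exact hv (h v hc)

theorem one_le_sum_of_mem {q : ι → ℝ} (hq : q ∈ K.cubicalRealization) {s : Finset ι}
    (h : ∀ v ∉ s, q v = 0) : 1 ≤ ∑ w ∈ s, q w := by
  obtain ⟨h0, ⟨v, hv⟩, -⟩ := hq
  have : v ∈ s := by
    by_contra hc
    rw [h v hc] at hv
    exact zero_ne_one hv
  rw [← hv]
  exact Finset.single_le_sum (f := q) (fun w _ => (h0 w).1) this

theorem one_le_finsum_of_mem {q : ι → ℝ} (hq : q ∈ K.cubicalRealization) : 1 ≤ ∑ᶠ w, q w := by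
  obtain ⟨s, -, h⟩ := hq.2.2
  rw [finsum_eq_sum_of_forall_notMem h]
  exact one_le_sum_of_mem hq h

theorem barycentric_mem {q : ι → ℝ} (hq : q ∈ K.cubicalRealization) :
    barycentric q ∈ K.realization := by
  have h1 := one_le_finsum_of_mem hq
  obtain ⟨h0, -, s, hs, h⟩ := hq
  refine ⟨fun v => div_nonneg (h0 v).1 (by linarith), s, hs, fun v hv => ?_, ?_⟩
  · simp [barycentric, h v hv]
  · simp only [barycentric]
    rw [← Finset.sum_div, ← finsum_eq_sum_of_forall_notMem h]
    exact div_self (by linarith)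

/-- Test the centre of the cell. Its free coordinates are half-integers, so free vertices lie in the
supporting face, and the vertex with coordinate 1 is not free. The extra free direction `none` makes
up for this one, whence the bound by the size of the face. -/
theorem exists_face_of_intCell_subset {a : Option ι → ℤ} {F : Finset (Option ι)}
    (h : intCell a F ⊆ K.cubicalCylinder) : ∃ s ∈ K.faces, F.card ≤ s.card ∧
      ∀ u ∈ intCell a F, ∀ v ∉ s, u (some v) = 0 := by
  classical
  let m : Option ι → ℝ := fun o => if o ∈ F then a o + 1 / 2 else a o
  have hmF : ∀ o ∈ F, m o = a o + 1 / 2 := fun o ho => if_pos ho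
  have hm : m ∈ intCell a F := by
    refine ⟨fun o ho => ?_, fun o ho => if_neg ho⟩
    rw [hmF o ho]; constructor <;> linarith
  have hint : ∀ o ∈ F, ∀ z : ℤ, m o ≠ z := by
    intro o ho z hz
    rw [hmF o ho] at hz
    have : (2 * a o + 1 : ℝ) = 2 * z := by linarith
    have : 2 * a o + 1 = 2 * z := by exact_mod_cast this
    omega
  obtain ⟨-, hbd, ⟨v₀, hv₀⟩, s, hs, hs0⟩ := h hm
  have hFs : ∀ v, some v ∈ F → v ∈ s := by
    intro v hv
    by_contra hc
    exact hint _ hv 0 (by simpa using hs0 v hc)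
  refine ⟨s, hs, ?_, fun u hu v hv => ?_⟩
  · have hv₀s : v₀ ∈ s := by
      by_contra hc
      have := hs0 v₀ hc
      simp only at hv₀ this
      rw [hv₀] at this
      exact one_ne_zero this
    have hsub : F ⊆ insert none ((s.erase v₀).map Function.Embedding.some) := by
      intro o ho
      cases o with
      | none => simp
      | some v =>
        have : v ≠ v₀ := by
          rintro rfl
          exact hint _ ho 1 (by simpa using hv₀)
        simp [this, hFs v ho]
    refine (Finset.card_le_card hsub).trans ((Finset.card_insert_le _ _).trans ?_)
    rw [Finset.card_map, Finset.card_erase_of_mem hv₀s]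
    have := Finset.card_pos.2 ⟨v₀, hv₀s⟩
    omega
  · have hvF : some v ∉ F := fun hc => hv (hFs v hc)
    rw [hu.2 _ hvF, ← hm.2 _ hvF]
    exact hs0 v hv

-- The base records the coordinates equal to 1, and those strictly between 0 and 1 are free. Moving
-- the latter changes neither the zeros nor the ones, so the cell stays in the cylinder. The bounds
-- by `S` later leave finitely many cells.
open Classical in
theorem exists_intCell_of_mem_cubicalCylinder {q : Option ι → ℝ} (hq : q ∈ K.cubicalCylinder)
    {S : Finset (Option ι)} (hS : ∀ o ∉ S, q o = 0) :
    ∃ A ⊆ S, ∃ F ⊆ S, intCell (fun o => if o ∈ A then 1 else 0) F ⊆ K.cubicalCylinder ∧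
      q ∈ intCell (fun o => if o ∈ A then 1 else 0) F ∧ ∀ o ∈ F, q o ≠ 0 ∧ q o ≠ 1 := by
  have h01 : ∀ o, 0 ≤ q o ∧ q o ≤ 1 := by
    rintro (_ | v)
    exacts [hq.1, hq.2.1 v]
  set A := S.filter fun o => q o = 1 with hA
  set F := S.filter fun o => q o ≠ 0 ∧ q o ≠ 1 with hF
  have hA0 : ∀ o, q o = 0 → o ∉ A := by
    intro o ho hc
    rw [hA, Finset.mem_filter, ho] at hc
    exact zero_ne_one hc.2
  have hA1 : ∀ o, q o = 1 → o ∈ A := by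
    intro o ho
    rw [hA, Finset.mem_filter]
    refine ⟨?_, ho⟩
    by_contra hc
    rw [hS o hc] at ho
    exact zero_ne_one ho
  have hFA : ∀ o ∈ F, o ∉ A := by
    intro o ho hc
    exact (Finset.mem_filter.1 ho).2.2 (Finset.mem_filter.1 hc).2
  have hval : ∀ o ∉ F, q o = 0 ∨ q o = 1 := by
    intro o ho
    by_contra hc
    push Not at hc
    refine ho (Finset.mem_filter.2 ⟨?_, hc⟩)
    by_contra hcS
    exact hc.1 (hS o hcS)
  have hu01 : ∀ u ∈ intCell (fun o => if o ∈ A then 1 else 0) F, ∀ o, 0 ≤ u o ∧ u o ≤ 1 := by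
    intro u hu o
    by_cases ho : o ∈ F
    · simpa [hFA o ho] using hu.1 o ho
    · rw [hu.2 o ho]; dsimp only; split_ifs <;> simp
  refine ⟨A, Finset.filter_subset _ _, F, Finset.filter_subset _ _, fun u hu => ⟨hu01 u hu _,
    fun v => hu01 u hu _, ?_, ?_⟩, ⟨fun o ho => ?_, fun o ho => ?_⟩,
    fun o ho => (Finset.mem_filter.1 ho).2⟩
  · obtain ⟨v, hv⟩ := hq.2.2.1
    refine ⟨v, ?_⟩
    have hvA := hA1 _ hv
    have hvF : some v ∉ F := fun hc => hFA _ hc hvA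
    simp only
    rw [hu.2 _ hvF]; simp [hvA]
  · obtain ⟨s, hs, h0⟩ := hq.2.2.2
    refine ⟨s, hs, fun v hv => ?_⟩
    have hvF : some v ∉ F := fun hc => (Finset.mem_filter.1 hc).2.1 (h0 v hv)
    simp only
    rw [hu.2 _ hvF]; simp [hA0 _ (h0 v hv)]
  · simpa [hFA o ho] using h01 o
  · rcases hval o ho with h | h
    · simp [hA0 o h, h]
    · simp [hA1 o h, h]

/-! ### Contracting the complex through its cylinder. -/

section Contraction

variable {X : Type*} [TopologicalSpace X] (φ : X ≃ₜ K.realization) {n : ℕ}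

open Classical in
/-- The map `cubicalRealization → X` given by barycentric coordinates. -/
noncomputable def ofCubical (x₀ : X) (q : ι → ℝ) : X :=
  if h : barycentric q ∈ K.realization then φ.symm ⟨barycentric q, h⟩ else x₀

theorem ofCubical_eq (x₀ : X) {q : ι → ℝ} (hq : q ∈ K.cubicalRealization) :
    ofCubical φ x₀ q = φ.symm ⟨barycentric q, barycentric_mem hq⟩ :=
  dif_pos (barycentric_mem hq)

theorem continuousOn_ofCubical (x₀ : X) {a : Option ι → ℤ} {F : Finset (Option ι)}
    (h : intCell a F ⊆ K.cubicalCylinder) :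
    ContinuousOn (fun q : Option ι → ℝ => ofCubical φ x₀ fun v => q (some v)) (intCell a F) := by
  obtain ⟨s, -, -, hs⟩ := exists_face_of_intCell_subset h
  rw [continuousOn_iff_continuous_domRestrict]
  have : (intCell a F).domRestrict
      (fun q : Option ι → ℝ => ofCubical φ x₀ fun v => q (some v)) = fun q =>
        φ.symm ⟨barycentric fun v => q.1 (some v), barycentric_mem (h q.2).2⟩ := by
    ext q; exact ofCubical_eq φ x₀ (h q.2).2
  rw [this]
  refine φ.symm.continuous.comp (Continuous.subtype_mk (continuous_pi fun v => ?_) _)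
  have hb : (fun q : intCell a F => barycentric (fun v => q.1 (some v)) v) = fun q =>
      q.1 (some v) / ∑ w ∈ s, q.1 (some w) := by
    ext q
    simp only [barycentric]
    rw [finsum_eq_sum_of_forall_notMem (hs q.1 q.2)]
  rw [hb]
  have hcoord : ∀ w, Continuous fun q : intCell a F => q.1 (some w) := fun w =>
    (continuous_apply (some w)).comp continuous_subtype_val
  refine (hcoord v).div (continuous_finsetSum _ fun w _ => hcoord w) fun q => ?_
  have := one_le_sum_of_mem (h q.2).2 (hs q.1 q.2)
  exact (by linarith : (0 : ℝ) < _).ne'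

/-- A homotopy, cell by cell, from the tautological map to a constant one. -/
theorem exists_cellwise_contraction (hdim : ∀ s ∈ K.faces, s.card ≤ n + 1)
    (hext : ∀ (a : Option ι → ℤ) (F : Finset (Option ι)) (f : (Option ι → ℝ) → X), F.Nonempty →
      F.card ≤ n + 1 → ContinuousOn f (intCellBdry a F) →
      ∃ f', ContinuousOn f' (intCell a F) ∧ Set.EqOn f' f (intCellBdry a F)) (x₀ : X) :
    ∃ f : (Option ι → ℝ) → X,
      (∀ a F, intCell a F ⊆ K.cubicalCylinder → ContinuousOn f (intCell a F)) ∧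
      ∀ q ∈ K.cubicalCylinder, (q none = 0 → f q = ofCubical φ x₀ fun v => q (some v)) ∧
        (q none = 1 → f q = x₀) := by
  classical
  have : Nonempty X := ⟨x₀⟩
  let P : (Option ι → ℤ) → Finset (Option ι) → ((Option ι → ℝ) → X) → Prop := fun a F f =>
    ((∀ q ∈ intCell a F, q none = 0) → ∀ q ∈ intCell a F,
      f q = ofCubical φ x₀ fun v => q (some v)) ∧
    ((∀ q ∈ intCell a F, q none = 1) → ∀ q ∈ intCell a F, f q = x₀)
  obtain ⟨f, hf⟩ := exists_skeletal_extension K.cubicalCylinder P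
    (by
      intro a F f g hfg h
      exact ⟨fun h' q hq => by rw [← hfg hq, h.1 h' q hq],
        fun h' q hq => by rw [← hfg hq, h.2 h' q hq]⟩)
    (by
      intro a F f hW hf hP
      have hmem := base_mem_intCell a F
      by_cases h0 : ∀ q ∈ intCell a F, q none = 0
      · refine ⟨_, continuousOn_ofCubical φ x₀ hW, fun q hq => ?_, fun _ _ _ => rfl, fun h => ?_⟩
        · obtain ⟨b, G, hb, hG, hqG⟩ := exists_facet_of_mem_intCellBdry hq
          exact ((hP b G hb hG).1 (fun u hu => h0 u (intCellBdry_subset _ _ (hb hu))) q hqG).symm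
        · have := h _ hmem
          rw [h0 _ hmem] at this
          exact absurd this zero_ne_one
      by_cases h1 : ∀ q ∈ intCell a F, q none = 1
      · refine ⟨fun _ => x₀, continuousOn_const, fun q hq => ?_, fun h => absurd h h0,
          fun _ _ _ => rfl⟩
        obtain ⟨b, G, hb, hG, hqG⟩ := exists_facet_of_mem_intCellBdry hq
        exact ((hP b G hb hG).2 (fun u hu => h1 u (intCellBdry_subset _ _ (hb hu))) q hqG).symm
      -- Otherwise the cell has constant integral height in [0, 1], so it lies in the bottom or the
      -- top, both already treated.
      have hF : none ∈ F := by
        by_contra hc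
        obtain ⟨h2, h3⟩ := (hW hmem).1
        have h2 : 0 ≤ a none := Int.cast_nonneg_iff.1 h2
        have h3 : a none ≤ 1 := Int.cast_le.1 (h3.trans_eq Int.cast_one.symm)
        rcases (by omega : a none = 0 ∨ a none = 1) with h | h
        · exact h0 fun q hq => by rw [hq.2 _ hc, h]; simp
        · exact h1 fun q hq => by rw [hq.2 _ hc, h]; simp
      obtain ⟨s, hs, hcard, -⟩ := exists_face_of_intCell_subset hW
      obtain ⟨f', e1, e2⟩ := hext a F f ⟨_, hF⟩ (hcard.trans (hdim s hs)) hf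
      exact ⟨f', e1, e2, fun h => absurd h h0, fun h => absurd h h1⟩) (n + 2)
  have hcard : ∀ a F, intCell a F ⊆ K.cubicalCylinder → F.card < n + 2 := by
    intro a F h
    obtain ⟨s, hs, hcard, -⟩ := exists_face_of_intCell_subset h
    exact Nat.lt_succ_of_le (hcard.trans (hdim s hs))
  refine ⟨f, fun a F h => (hf a F h (hcard a F h)).1, fun q hq => ?_⟩
  obtain ⟨s, -, hs⟩ := hq.2.2.2
  obtain ⟨A, -, F, -, hc, hqc, hqF⟩ := exists_intCell_of_mem_cubicalCylinder hq
    (S := insert none (s.map Function.Embedding.some)) (by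
      rintro (_ | v) ho
      · simp at ho
      · exact hs v (by simpa using ho))
  obtain ⟨-, p0, p1⟩ := hf _ F hc (hcard _ F hc)
  have hnone : none ∉ F → ∀ u ∈ intCell (fun o => if o ∈ A then 1 else 0) F,
      u none = q none := fun hn u hu => by rw [hu.2 _ hn, ← hqc.2 _ hn]
  constructor
  · intro h
    exact p0 (fun u hu => (hnone (fun hn => (hqF _ hn).1 h) u hu).trans h) q hqc
  · intro h
    exact p1 (fun u hu => (hnone (fun hn => (hqF _ hn).2 h) u hu).trans h) q hqc

variable (n) in
/-- Truncation of barycentric coordinates: only finitely many of the new coordinates are nonzero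
near a given point. -/
noncomputable def truncate (p : ι → ℝ) (v : ι) : ℝ := max 0 (min 1 (2 * (n + 1) * p v - 1))

/-- At most n + 1 coordinates sum to 1, so one is at least 1/(n + 1), and truncation sends that one
to 1. -/
theorem truncate_mem (hdim : ∀ s ∈ K.faces, s.card ≤ n + 1) {p : ι → ℝ} (hp : p ∈ K.realization) :
    truncate n p ∈ K.cubicalRealization := by
  obtain ⟨h0, s, hs, h, hsum⟩ := hp
  refine ⟨fun v => ⟨le_max_left _ _, max_le zero_le_one (min_le_left _ _)⟩, ?_, s, hs,
    fun v hv => ?_⟩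
  · by_contra! hc
    have hlt : ∀ v ∈ s, p v < 1 / (n + 1) := by
      intro v _
      by_contra! hv
      refine hc v ?_
      rw [div_le_iff₀ (by positivity)] at hv
      have : 1 ≤ 2 * ((n : ℝ) + 1) * p v - 1 := by linarith
      rw [truncate, min_eq_left this, max_eq_right zero_le_one]
    have hne : s.Nonempty := by
      rw [Finset.nonempty_iff_ne_empty]
      rintro rfl
      simp at hsum
    have h1 := Finset.sum_lt_sum_of_nonempty hne hlt
    rw [hsum, Finset.sum_const, nsmul_eq_mul, mul_one_div, lt_div_iff₀ (by positivity), one_mul]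
      at h1
    have h2 : (s.card : ℝ) ≤ n + 1 := by exact_mod_cast hdim s hs
    linarith
  · simp [truncate, h v hv]

theorem truncate_eq_zero {p : ι → ℝ} {v : ι} (h : p v = 0) : truncate n p v = 0 := by
  simp [truncate, h]

-- Near `x` the vertices supporting `x` carry total weight above 1 - 1/(2(n + 1)), so every other
-- coordinate lies below the truncation threshold. No local finiteness is needed.
variable (n) in
theorem exists_nhds_truncate_eq_zero (x : X) :
    ∃ S : Finset ι, ∀ᶠ y in 𝓝 x, ∀ v ∉ S, truncate n (φ y).1 v = 0 := by
  classical
  obtain ⟨h0, s, hs, h, hsum⟩ := (φ x).2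
  refine ⟨s, ?_⟩
  have hc : Continuous fun y => ∑ v ∈ s, (φ y).1 v :=
    continuous_finsetSum _ fun v _ =>
      (continuous_apply v).comp (continuous_subtype_val.comp φ.continuous)
  have hlt : 1 - 1 / (2 * ((n : ℝ) + 1)) < ∑ v ∈ s, (φ x).1 v := by
    rw [hsum]
    have : 0 < 1 / (2 * ((n : ℝ) + 1)) := by positivity
    linarith
  filter_upwards [hc.continuousAt.eventually (lt_mem_nhds hlt)] with y hy v hv
  have h1 := sum_le_one_of_mem_realization (φ y).2 (insert v s)
  rw [Finset.sum_insert hv] at h1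
  have h2 : (φ y).1 v < 1 / (2 * ((n : ℝ) + 1)) := by linarith
  rw [lt_div_iff₀ (by positivity)] at h2
  have h3 : 2 * ((n : ℝ) + 1) * (φ y).1 v - 1 ≤ 0 := by linarith
  exact max_eq_left ((min_le_right _ _).trans h3)

variable (n) in
theorem continuous_truncate (v : ι) : Continuous fun x => truncate n (φ x).1 v := by
  have : Continuous fun x => (φ x).1 v :=
    (continuous_apply v).comp (continuous_subtype_val.comp φ.continuous)
  unfold truncate
  fun_prop

theorem continuous_barycentric_truncate (hdim : ∀ s ∈ K.faces, s.card ≤ n + 1) (v : ι) :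
    Continuous fun x => barycentric (truncate n (φ x).1) v := by
  refine (continuous_truncate φ n v).div ?_ fun x => ?_
  · refine continuous_iff_continuousAt.2 fun x => ?_
    obtain ⟨S, hS⟩ := exists_nhds_truncate_eq_zero φ n x
    have : ContinuousAt (fun y => ∑ w ∈ S, truncate n (φ y).1 w) x :=
      (continuous_finsetSum _ fun w _ => continuous_truncate φ n w).continuousAt
    refine this.congr (hS.mono fun y hy => ?_)
    exact (finsum_eq_sum_of_forall_notMem hy).symm
  · have := one_le_finsum_of_mem (truncate_mem hdim (φ x).2)
    exact (by linarith : (0 : ℝ) < _).ne'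

/-- Truncation never enlarges the support, so the segment stays in one closed simplex. -/
theorem lineMap_mem_realization (hdim : ∀ s ∈ K.faces, s.card ≤ n + 1) {p : ι → ℝ}
    (hp : p ∈ K.realization) {t : ℝ} (ht0 : 0 ≤ t) (ht1 : t ≤ 1) :
    (fun v => (1 - t) * p v + t * barycentric (truncate n p) v) ∈ K.realization := by
  have hb := truncate_mem hdim hp
  have h1 := one_le_finsum_of_mem hb
  have hb0 := (barycentric_mem hb).1
  obtain ⟨h0, s, hs, h, hsum⟩ := hp
  have hz : ∀ v ∉ s, truncate n p v = 0 := fun v hv => truncate_eq_zero (h v hv)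
  refine ⟨fun v => add_nonneg (mul_nonneg (by linarith) (h0 v)) (mul_nonneg ht0 (hb0 v)), s, hs,
    fun v hv => ?_, ?_⟩
  · simp [h v hv, barycentric, hz v hv]
  · rw [Finset.sum_add_distrib, ← Finset.mul_sum, ← Finset.mul_sum, hsum]
    have : ∑ v ∈ s, barycentric (truncate n p) v = 1 := by
      simp only [barycentric]
      rw [← Finset.sum_div, ← finsum_eq_sum_of_forall_notMem hz]
      exact div_self (by linarith)
    rw [this]; ring

/-- A nonempty complex of dimension at most `n` is contractible if maps to it from boundaries of
cells of dimension at most `n + 1` extend to the cells. -/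
theorem contractibleSpace_of_cell_extension (φ : X ≃ₜ K.realization)
    (hdim : ∀ s ∈ K.faces, s.card ≤ n + 1)
    (hext : ∀ (a : Option ι → ℤ) (F : Finset (Option ι)) (f : (Option ι → ℝ) → X), F.Nonempty →
      F.card ≤ n + 1 → ContinuousOn f (intCellBdry a F) →
      ∃ f', ContinuousOn f' (intCell a F) ∧ Set.EqOn f' f (intCellBdry a F)) (x₀ : X) :
    ContractibleSpace X := by
  classical
  obtain ⟨f, hf, hf01⟩ := exists_cellwise_contraction φ hdim hext x₀
  let m : C(X, X) := ⟨fun x => φ.symm ⟨_, barycentric_mem (truncate_mem hdim (φ x).2)⟩,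
    φ.symm.continuous.comp (Continuous.subtype_mk
      (continuous_pi fun v => continuous_barycentric_truncate φ hdim v) _)⟩
  have h1 : (ContinuousMap.id X).Homotopic m := by
    refine ⟨⟨⟨fun p => φ.symm ⟨_, lineMap_mem_realization hdim (φ p.2).2 p.1.2.1 p.1.2.2⟩, ?_⟩,
      fun x => ?_, fun x => ?_⟩⟩
    · refine φ.symm.continuous.comp (Continuous.subtype_mk (continuous_pi fun v => ?_) _)
      have e1 : Continuous fun x => (φ x).1 v :=
        (continuous_apply v).comp (continuous_subtype_val.comp φ.continuous)
      have e2 := continuous_barycentric_truncate φ hdim v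
      have e3 : Continuous fun p : unitInterval × X => (p.1 : ℝ) :=
        continuous_subtype_val.comp continuous_fst
      exact ((continuous_const.sub e3).mul (e1.comp continuous_snd)).add
        (e3.mul (e2.comp continuous_snd))
    · simp
    · simp [m]
  let c : unitInterval × X → Option ι → ℝ := fun p o => o.elim p.1.1 (truncate n (φ p.2).1)
  have hc : Continuous c := by
    refine continuous_pi fun o => ?_
    cases o with
    | none => exact continuous_subtype_val.comp continuous_fst
    | some v => exact (continuous_truncate φ n v).comp continuous_snd
  have hcW : ∀ p, c p ∈ K.cubicalCylinder := fun p => ⟨p.1.2, truncate_mem hdim (φ p.2).2⟩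
  -- Near `p`, `c` takes values in a finite union of closed cells, where continuity on each cell
  -- suffices.
  have hfc : Continuous fun p => f (c p) := by
    refine continuous_iff_continuousAt.2 fun p => ?_
    obtain ⟨S, hS⟩ := exists_nhds_truncate_eq_zero φ n p.2
    set S' : Finset (Option ι) := insert none (S.map Function.Embedding.some) with hS'
    let C : Finset (Option ι) × Finset (Option ι) → Set (Option ι → ℝ) := fun c =>
      intCell (fun o => if o ∈ c.1 then 1 else 0) c.2
    let T := {c : ↥(S'.powerset ×ˢ S'.powerset) // C c.1 ⊆ K.cubicalCylinder}
    have hT : ContinuousOn f (⋃ t : T, C t.1.1) :=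
      (locallyFinite_of_finite _).continuousOn_iUnion (fun t => isClosed_intCell _ _)
        fun t => hf _ _ t.2
    have hev : ∀ᶠ y in 𝓝 p, c y ∈ ⋃ t : T, C t.1.1 := by
      filter_upwards [continuous_snd.continuousAt.eventually hS] with y hy
      obtain ⟨A, hA, F, hF, h1, h2, -⟩ := exists_intCell_of_mem_cubicalCylinder (hcW y)
        (S := S') (by
          rintro (_ | v) ho
          · simp [hS'] at ho
          · exact hy v (by simpa [hS'] using ho))
      exact Set.mem_iUnion.2 ⟨⟨⟨(A, F), Finset.mem_product.2
        ⟨Finset.mem_powerset.2 hA, Finset.mem_powerset.2 hF⟩⟩, h1⟩, h2⟩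
    exact Filter.Tendsto.comp (hT _ hev.self_of_nhds)
      (tendsto_nhdsWithin_iff.2 ⟨hc.continuousAt, hev⟩)
  have h2 : m.Homotopic (ContinuousMap.const X x₀) := by
    refine ⟨⟨⟨fun p => f (c p), hfc⟩, fun x => ?_, fun x => ?_⟩⟩
    · have := (hf01 _ (hcW (0, x))).1 rfl
      exact this.trans (ofCubical_eq φ x₀ (truncate_mem hdim (φ x).2))
    · exact (hf01 _ (hcW (1, x))).2 rfl
  exact (contractible_iff_id_nullhomotopic X).2 ⟨x₀, h1.trans h2⟩

end Contraction

end AbstractSimplicialComplex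

/-! ### The case `δ = 0`. -/

section Tree

variable {X : Type*} [MetricSpace X]

/-- A path connected `0`-hyperbolic space is geodesic. -/
theorem IsGromovHyperbolic.exists_dist_eq_of_path (hhyp : IsGromovHyperbolic X 0) {x y : X}
    (γ : Path x y) {s : ℝ} (hs0 : 0 ≤ s) (hs1 : s ≤ 1) :
    ∃ z, dist x z = s * dist x y ∧ dist x z + dist z y = dist x y := by
  rcases (mul_le_of_le_one_left (dist_nonneg (x := x) (y := y)) hs1).eq_or_lt with h | hlt
  · exact ⟨y, h.symm, by simp⟩
  set c := s * dist x y with hc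
  have hc0 : 0 ≤ c := by positivity
  have hγ : Continuous γ.extend := γ.continuous_extend
  let u : ℝ → ℝ := fun t => gromovProduct (γ.extend t) y x
  have hu : Continuous u := by unfold u gromovProduct; fun_prop
  have hu1 : ∀ t, 1 ≤ t → u t = dist x y := by
    intro t ht
    simp [u, γ.extend_of_one_le ht, gromovProduct]
  -- The point sought is the path at the last time when its Gromov product with `y` is at most `c`.
  have hA : IsCompact (Set.Icc (0 : ℝ) 1 ∩ {t | u t ≤ c}) :=
    isCompact_Icc.inter_right (isClosed_le hu continuous_const)
  obtain ⟨τ, ⟨⟨hτ0, hτ1⟩, hτc⟩, hτ⟩ := hA.exists_isGreatest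
    ⟨0, ⟨le_rfl, zero_le_one⟩, by simpa [u, gromovProduct] using hc0⟩
  have hgt : ∀ t, τ < t → c < u t := by
    intro t ht
    by_contra! hle
    rcases le_or_gt t 1 with h1 | h1
    · exact (hτ ⟨⟨hτ0.trans ht.le, h1⟩, hle⟩).not_gt ht
    · rw [hu1 t h1.le] at hle
      exact hle.not_gt hlt
  have hut : u τ = c := by
    refine le_antisymm hτc (ge_of_tendsto (hu.continuousWithinAt (s := Set.Ioi τ) (x := τ)) ?_)
    filter_upwards [self_mem_nhdsWithin] with t ht using (hgt t ht).le
  -- For t after τ the product of γ(t) with `y` exceeds `c`, so 0-hyperbolicity bounds the product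
  -- of γ(τ) with γ(t) by `c`; let t tend to τ.
  have hle : dist x (γ.extend τ) ≤ c := by
    have hv : Continuous fun t => gromovProduct (γ.extend τ) (γ.extend t) x := by
      unfold gromovProduct; fun_prop
    have hvτ : gromovProduct (γ.extend τ) (γ.extend τ) x = dist x (γ.extend τ) := by
      simp [gromovProduct]
    rw [← hvτ]
    refine le_of_tendsto (hv.continuousWithinAt (s := Set.Ioi τ) (x := τ)) ?_
    filter_upwards [self_mem_nhdsWithin] with t ht
    have h := hhyp (γ.extend τ) (γ.extend t) y x
    have h2 : gromovProduct (γ.extend τ) y x = c := hut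
    rw [h2, sub_zero] at h
    exact (min_le_iff.1 h).resolve_right (hgt t ht).not_ge
  have h3 : (dist x (γ.extend τ) + dist x y - dist (γ.extend τ) y) / 2 = c := hut
  have h4 := dist_triangle x (γ.extend τ) y
  exact ⟨γ.extend τ, by linarith, by linarith⟩

/-- Sliding along geodesics towards `x₀` is jointly continuous, since `dist_le` with δ = ε = 0
controls points on neighbouring geodesics. -/
theorem IsGromovHyperbolic.contractibleSpace_of_zero (hhyp : IsGromovHyperbolic X 0)
    (hpath : ∀ x y : X, Nonempty (Path x y)) (x₀ : X) : ContractibleSpace X := by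
  have h : ∀ (t : unitInterval) (y : X), ∃ z, dist x₀ z = (1 - t) * dist x₀ y ∧
      dist x₀ z + dist z y = dist x₀ y := fun t y =>
    hhyp.exists_dist_eq_of_path (hpath x₀ y).some (by linarith [t.2.2]) (by linarith [t.2.1])
  choose z hz1 hz2 using h
  have hzc : Continuous fun p : unitInterval × X => z p.1 p.2 := by
    refine continuous_iff_continuousAt.2 fun p => ?_
    have hR : Continuous fun q : unitInterval × X =>
        |(1 - (q.1 : ℝ)) * dist x₀ q.2 - (1 - (p.1 : ℝ)) * dist x₀ p.2| +
          2 * dist q.2 p.2 := by fun_prop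
    have hR0 := hR.tendsto p
    simp only [sub_self, abs_zero, dist_self, mul_zero, add_zero] at hR0
    refine tendsto_iff_dist_tendsto_zero.2
      (squeeze_zero (fun _ => dist_nonneg) (fun q => ?_) hR0)
    have := hhyp.dist_le le_rfl le_rfl (by rw [add_zero]; exact (hz2 q.1 q.2).le)
      (by rw [add_zero]; exact (hz2 p.1 p.2).le)
    rw [← hz1, ← hz1]
    linarith
  refine (contractible_iff_id_nullhomotopic X).2 ⟨x₀, ⟨⟨⟨_, hzc⟩, fun y => ?_, fun y => ?_⟩⟩⟩
  · have h1 := hz1 0 y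
    have h2 := hz2 0 y
    have : dist (z 0 y) y = 0 := by simp at h1; linarith
    exact dist_eq_zero.1 this
  · have h1 := hz1 1 y
    have : dist x₀ (z 1 y) = 0 := by simpa using h1
    exact (dist_eq_zero.1 this).symm

end Tree

/-! ### Homotopy groups of a contractible space. -/

section HomotopyGroups

variable {X : Type*} [TopologicalSpace X]

theorem isNullHomotopicIn_univ [ContractibleSpace X] :
    IsNullHomotopicIn (Set.univ : Set X) Set.univ := by
  refine ⟨subset_rfl, ?_⟩
  have h := (id_nullhomotopic X).comp_right
    (⟨fun x => ⟨x, trivial⟩, by fun_prop⟩ : C(X, (Set.univ : Set X)))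
  exact h.comp_left (⟨Subtype.val, continuous_subtype_val⟩ : C((Set.univ : Set X), X))

/-- In a contractible space all generalized loops are homotopic. -/
theorem GenLoop.homotopic_of_contractibleSpace [ContractibleSpace X] {N : Type*} [Fintype N]
    {x : X} (p p' : GenLoop N X x) : GenLoop.Homotopic p p' := by
  classical
  let b : (Option N → ℝ) → N → unitInterval := fun q i => Set.projIcc 0 1 zero_le_one (q (some i))
  have hb : Continuous b := continuous_pi fun i => continuous_projIcc.comp (continuous_apply _)
  -- On the boundary of the prism: `p` on the bottom, `p'` on the top, the base point on the sides.
  -- A filling is a homotopy relative to the boundary.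
  let f : (Option N → ℝ) → X := fun q =>
    if q none = 0 then p (b q) else if q none = 1 then p' (b q) else x
  have hp : Continuous p := p.1.continuous
  have hp' : Continuous p' := p'.1.continuous
  have hfx : ∀ q, b q ∈ Cube.boundary N → f q = x := by
    intro q hq
    simp only [f]
    rw [GenLoop.boundary p _ hq, GenLoop.boundary p' _ hq]
    simp
  have hf : ContinuousOn f (intCellBdry (0 : Option N → ℤ) Finset.univ) := by
    refine continuousOn_intCellBdry fun a G hG _ => ?_
    -- If the height is free, the centre of the face shows that another coordinate is fixed at 0 or
    -- 1, so the face lies in the sides.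
    by_cases hn : none ∈ G
    · let m : Option N → ℝ := fun o => if o ∈ G then a o + 1 / 2 else a o
      have hm : m ∈ intCell a G := by
        refine ⟨fun o ho => ?_, fun o ho => if_neg ho⟩
        simp only [m, if_pos ho]; constructor <;> linarith
      obtain ⟨-, j, -, hj⟩ := hG hm
      have hjG : j ∉ G := by
        intro hc
        have hmj : m j = a j + 1 / 2 := if_pos hc
        rw [hmj] at hj
        rcases hj with h | h
        · have : ((2 * a j + 1 : ℤ) : ℝ) = (0 : ℤ) := by
            push_cast; simp at h; linarith
          have := Int.cast_injective this
          omega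
        · have : ((2 * a j + 1 : ℤ) : ℝ) = (2 : ℤ) := by
            push_cast; simp at h; linarith
          have := Int.cast_injective this
          omega
      cases j with
      | none => exact absurd hn hjG
      | some i =>
        refine (continuousOn_const (c := x)).congr fun q hq => hfx q ⟨i, ?_⟩
        have hqj : q (some i) = m (some i) := by rw [hq.2 _ hjG, hm.2 _ hjG]
        simp only [b, hqj]
        rcases hj with h | h <;> rw [h] <;> simp
    · by_cases h0 : (a none : ℝ) = 0
      · refine (hp.comp hb).continuousOn.congr fun q hq => ?_
        simp [f, hq.2 _ hn, h0]
      · by_cases h1 : (a none : ℝ) = 1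
        · refine (hp'.comp hb).continuousOn.congr fun q hq => ?_
          simp [f, hq.2 _ hn, h1]
        · refine (continuousOn_const (c := x)).congr fun q hq => ?_
          simp only [f, hq.2 _ hn, if_neg h0, if_neg h1]
  obtain ⟨f', hf', hff, -⟩ := isNullHomotopicIn_univ.exists_extension Finset.univ_nonempty hf
    (Set.mapsTo_univ _ _)
  let c : unitInterval × (N → unitInterval) → Option N → ℝ := fun y o =>
    o.elim (y.1 : ℝ) fun i => (y.2 i : ℝ)
  have hc : Continuous c := by
    refine continuous_pi fun o => ?_
    cases o with
    | none => exact continuous_subtype_val.comp continuous_fst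
    | some i => exact continuous_subtype_val.comp ((continuous_apply i).comp continuous_snd)
  have hcQ : ∀ y, c y ∈ intCell (0 : Option N → ℤ) Finset.univ := by
    intro y
    refine ⟨fun o _ => ?_, fun o ho => absurd (Finset.mem_univ o) ho⟩
    simp only [Pi.zero_apply, Int.cast_zero, zero_add]
    cases o with
    | none => exact y.1.2
    | some i => exact (y.2 i).2
  have hbc : ∀ y, b (c y) = y.2 := by
    intro y
    funext i
    exact Set.projIcc_val zero_le_one (y.2 i)
  have hval : ∀ y, c y ∈ intCellBdry (0 : Option N → ℤ) Finset.univ → f' (c y) = f (c y) :=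
    fun y hy => hff hy
  refine ⟨⟨⟨⟨fun y => f' (c y), hf'.comp_continuous hc hcQ⟩, fun y => ?_, fun y => ?_⟩,
    fun t y hy => ?_⟩⟩
  · have h0 : c (0, y) none = 0 := rfl
    have h := hval (0, y) ⟨hcQ _, none, Finset.mem_univ _, Or.inl (by simp [h0])⟩
    simp only [f, h0, if_true, hbc] at h
    exact h
  · have h0 : c (1, y) none = 1 := rfl
    have h := hval (1, y) ⟨hcQ _, none, Finset.mem_univ _, Or.inr (by simp [h0])⟩
    simp only [f, h0, if_true, hbc, one_ne_zero, if_false] at h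
    exact h
  · have h : f' (c (t, y)) = x := by
      rw [hval (t, y), hfx _ (by rwa [hbc])]
      obtain ⟨i, hi⟩ := hy
      have hci : c (t, y) (some i) = y i := rfl
      refine ⟨hcQ _, some i, Finset.mem_univ _, ?_⟩
      rcases hi with hi | hi <;> simp [hci, hi]
    exact h.trans (p.2 y hy).symm

theorem subsingleton_homotopyGroup [ContractibleSpace X] (k : ℕ) (x : X) :
    Subsingleton (π_ k X x) :=
  ⟨fun α β => Quotient.inductionOn₂ α β fun p p' =>
    Quotient.sound (GenLoop.homotopic_of_contractibleSpace p p')⟩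

end HomotopyGroups

/-! ### Conclusion. -/

theorem AbstractSimplicialComplex.nonempty_realization {ι : Type*}
    (K : AbstractSimplicialComplex ι) {s : Finset ι} (hs : s ∈ K.faces) (hne : s.Nonempty) :
    K.realization.Nonempty := by
  classical
  have : (s.card : ℝ) ≠ 0 := by exact_mod_cast hne.card_pos.ne'
  refine ⟨fun v => if v ∈ s then (s.card : ℝ)⁻¹ else 0, fun v => ?_, s, hs,
    fun v hv => if_neg hv, ?_⟩
  · dsimp only; split_ifs <;> positivity
  · rw [Finset.sum_congr rfl fun v hv => if_pos hv]
    simp [this]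

theorem mainTheorem5 {X : Type*} [MetricSpace X]
    {ι : Type*} (K : AbstractSimplicialComplex ι) (φ : X ≃ₜ K.realization)
    (n : ℕ) (hdim : K.HasDimension n)
    (δ : ℝ) (hδ : 0 ≤ δ) (hlen : IsLengthMetric X) (hhyp : IsGromovHyperbolic X δ)
    (hball : ∀ r : ℝ, 0 < r → r ≤ 8 * ((n : ℝ) + 1) * δ →
      ∀ x : X, IsNullHomotopicIn (Metric.ball x r) (Metric.ball x (r + 4 * δ))) :
    (∀ (k : ℕ) (x : X), Subsingleton (π_ k X x)) ∧ ContractibleSpace X := by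
  obtain ⟨⟨s, hs, hcard⟩, hle⟩ := hdim
  obtain ⟨q, hq⟩ := K.nonempty_realization hs (Finset.card_pos.1 (by omega))
  have hX : ContractibleSpace X := by
    -- For δ = 0 no radius lies in the range of `hball`, so balls give no fillings and geodesics
    -- replace them.
    rcases hδ.eq_or_lt with rfl | hδ
    · exact hhyp.contractibleSpace_of_zero (fun x y => ⟨(hlen x y 1 one_pos).choose⟩)
        (φ.symm ⟨q, hq⟩)
    · exact AbstractSimplicialComplex.contractibleSpace_of_cell_extension φ hle
        (fun a F f hF hFn hf => hhyp.exists_cell_extension hδ hlen hball a hF hFn hf)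
        (φ.symm ⟨q, hq⟩)
  exact ⟨fun k x => subsingleton_homotopyGroup k x, hX⟩
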